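/- Let $a,b$ be operators with $ab-ba=b^2$. An (a,b)-module is a free $\mathbb{C}[[b]]$-module of finite rank with a $\mathbb{C}$-linear endomorphism $a$ such that $aS=Sa+b^2S'$ for all $S\in\mathbb{C}[[b]]$; submodules are the $\mathbb{C}[[b]]$-submodules stable under $a$, and morphisms are the $\mathbb{C}[[b]]$-linear maps commuting with $a$. For $\lambda\in\mathbb{C}$ let $E_\lambda$ be the (a,b)-module of rank $1$ with a generator $e$ satisfying $ae=\lambda be$. An (a,b)-module has a simple pole if $aM\subset bM$, and it is regular if it embeds in one with a simple pole. A submodule $F\subset E$ is normal if $F\cap bE=bF$. A Jordan–Hölder sequence of $E$ is a sequence $0=F_0\subset F_1\subset\dots\subset F_k=E$ of normal submodules with all quotients $F_j/F_{j-1}$ of rank $1$; its numbers are the $\lambda_1,\dots,\lambda_k$ with $F_j/F_{j-1}\simeq E_{\lambda_j}$. An (a,b)-module is semi-simple if it is isomorphic to a submodule of a finite direct sum of regular (a,b)-modules of rank $1$, and the semi-simple part $S_1(E)$ is the submodule generated by the elements $x\in E$ such that the submodule generated by $x$ is semi-simple (these elements in fact form a submodule). A fresco is a module isomorphic to the submodule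 generated by one element of $$\Big(\bigoplus_{\lambda\in\Lambda}\bigoplus_{j=0}^{N}\mathbb{C}[[s]]\,s^{\lambda-1}(\log s)^j\Big)\otimes_{\mathbb{C}}V,$$ where $\Lambda\subset\mathbb{Q}\cap\,]0,1]$ is finite, $N\in\mathbb{N}$, $V$ is a finite-dimensional complex vector space, $a$ is the multiplication by $s$ and $b$ is the primitive in $s$ without constant. Let $E$ be a fresco, let $\lambda_1,\dots,\lambda_k$ be the numbers of any Jordan–Hölder sequence of $E$, and let $\mu_1,\dots,\mu_d$ be the numbers of any Jordan–Hölder sequence of $S_1(E)$. Then, for each $j\in[1,k]$, there exists a normal submodule of $E$ of rank $1$ isomorphic to $E_{\lambda_j+j-1}$ if and only if there exists $i\in[1,d]$ with $\lambda_j+j-1=\mu_i+i-1$. Moreover, this gives all isomorphism classes of normal submodules of rank $1$ of $E$: every such submodule is isomorphic to $E_{\lambda_j+j-1}$ for some $j\in[1,k]$ such that $\lambda_j+j-1=\mu_i+i-1$ for some $i\in[1,d]$. -/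

import Mathlib

noncomputable section

namespace FormalAB

open scoped TensorProduct

/-- The ring `ℂ[[b]]`; the variable `PowerSeries.X` is the operator usually called `b`. -/
abbrev Cb : Type := PowerSeries ℂ

/-- The variable `b` of `ℂ[[b]]`. -/
abbrev b : Cb := PowerSeries.X

/-- An action of the operator `a` on a `ℂ[[b]]`-module: an additive map `a` with
`a S = S a + b² S'` for every `S ∈ ℂ[[b]]`; in particular `a b - b a = b²`. As constants have
derivative zero, such a map is `ℂ`-linear. An (a,b)-module is a free `ℂ[[b]]`-module of finite rank
with such an action. -/
class ABAction (E : Type*) [AddCommGroup E] [Module Cb E] where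
  /-- The operator `a`. -/
  a : E →+ E
  a_smul : ∀ (S : Cb) (x : E), a (S • x) = S • a x + (b ^ 2 * PowerSeries.derivative ℂ S) • x

/-- The operator `a` of an action. -/
def a {E : Type*} [AddCommGroup E] [Module Cb E] [ABAction E] : E →+ E := ABAction.a

theorem a_smul {E : Type*} [AddCommGroup E] [Module Cb E] [ABAction E] (S : Cb) (x : E) :
    a (S • x) = S • a x + (b ^ 2 * PowerSeries.derivative ℂ S) • x :=
  ABAction.a_smul S x

/-! ### Morphisms -/

/-- There is an isomorphism: a `ℂ[[b]]`-linear bijection that commutes with `a`. -/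
def Iso (E F : Type*) [AddCommGroup E] [Module Cb E] [ABAction E]
    [AddCommGroup F] [Module Cb F] [ABAction F] : Prop :=
  ∃ f : E ≃ₗ[Cb] F, ∀ x, f (a x) = a (f x)

/-- There is an embedding: an injective `ℂ[[b]]`-linear map that commutes with `a`. -/
def Embeds (E F : Type*) [AddCommGroup E] [Module Cb E] [ABAction E]
    [AddCommGroup F] [Module Cb F] [ABAction F] : Prop :=
  ∃ f : E →ₗ[Cb] F, Function.Injective f ∧ ∀ x, f (a x) = a (f x)

/-! ### Submodules and quotients -/

/-- A submodule: a `ℂ[[b]]`-submodule stable under `a`. -/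
structure Sub (E : Type*) [AddCommGroup E] [Module Cb E] [ABAction E] where
  /-- The underlying `ℂ[[b]]`-submodule. -/
  mod : Submodule Cb E
  a_mem : ∀ x ∈ mod, a x ∈ mod

section Submodules

variable {E : Type*} [AddCommGroup E] [Module Cb E] [ABAction E]

instance instABActionSub (F : Sub E) : ABAction F.mod where
  a := ((a : E →+ E).comp F.mod.subtype.toAddMonoidHom).codRestrict F.mod
    (fun x => F.a_mem x x.2)
  a_smul S x := Subtype.ext (a_smul S (x : E))

instance instABActionQuotient (F : Sub E) : ABAction (E ⧸ F.mod) where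
  a := QuotientAddGroup.map F.mod.toAddSubgroup F.mod.toAddSubgroup a (fun x hx => F.a_mem x hx)
  a_smul S x := by
    obtain ⟨y, rfl⟩ := Submodule.Quotient.mk_surjective F.mod x
    exact congrArg (Submodule.Quotient.mk (p := F.mod)) (a_smul S y)

/-- The intersection `F ∩ G`, as a submodule of `G`. -/
def Sub.within (F G : Sub E) : Sub G.mod where
  mod := F.mod.comap G.mod.subtype
  a_mem x hx := F.a_mem x hx

/-- The submodule generated by a set: the smallest submodule that contains it. -/
def Sub.gen (s : Set E) : Sub E where
  mod := sInf {P | s ⊆ P ∧ ∀ x ∈ P, a x ∈ P}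
  a_mem x hx := by
    rw [Submodule.mem_sInf] at hx ⊢
    exact fun P hP => hP.2 x (hx P hP)

/-- `F` is normal in `E`: `F ∩ b E = b F`. -/
def Sub.IsNormal (F : Sub E) : Prop :=
  ∀ x : E, (x ∈ F.mod ∧ ∃ y : E, x = b • y) ↔ ∃ y ∈ F.mod, x = b • y

end Submodules

/-! ### Direct sums and tensor products with complex vector spaces -/

instance instABActionPi {ι : Type*} (M : ι → Type*) [∀ i, AddCommGroup (M i)]
    [∀ i, Module Cb (M i)] [∀ i, ABAction (M i)] : ABAction (∀ i, M i) where
  a := AddMonoidHom.mk' (fun x i => a (x i)) (fun x y => funext fun i => map_add a (x i) (y i))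
  a_smul S x := funext fun i => a_smul S (x i)

/-- The operator `a`, as a `ℂ`-linear map. -/
def aLin (E : Type*) [AddCommGroup E] [Module Cb E] [ABAction E] [Module ℂ E]
    [IsScalarTower ℂ Cb E] : E →ₗ[ℂ] E where
  toFun := a
  map_add' := map_add a
  map_smul' c x := by
    have h := a_smul (algebraMap ℂ Cb c) x
    rw [algebraMap_smul, algebraMap_smul, Derivation.map_algebraMap, mul_zero, zero_smul,
      add_zero] at h
    exact h

/-- `S (φ ⊗ v) = (S φ) ⊗ v` and `a (φ ⊗ v) = (a φ) ⊗ v`. -/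
instance instABActionTensor (E V : Type*) [AddCommGroup E] [Module Cb E] [ABAction E] [Module ℂ E]
    [IsScalarTower ℂ Cb E] [AddCommGroup V] [Module ℂ V] : ABAction (E ⊗[ℂ] V) where
  a := ((aLin E).rTensor V).toAddMonoidHom
  a_smul S x := by
    induction x using TensorProduct.induction_on with
    | zero => simp
    | tmul y v =>
      change (aLin E (S • y)) ⊗ₜ[ℂ] v = (S • aLin E y) ⊗ₜ[ℂ] v + (_ • y) ⊗ₜ[ℂ] v
      rw [← TensorProduct.add_tmul]
      exact congrArg (· ⊗ₜ[ℂ] v) (a_smul S y)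
    | add y z hy hz =>
      rw [smul_add, map_add, hy, hz, map_add, smul_add, smul_add]
      abel

/-! ### Regular and semi-simple (a,b)-modules -/

/-- A bundled (a,b)-module. A free `ℂ[[b]]`-module of finite rank has a copy in the lowest
universe, so that this universe is enough. -/
structure ABMod where
  /-- The underlying type. -/
  carrier : Type
  [grp : AddCommGroup carrier]
  [mod : Module Cb carrier]
  [act : ABAction carrier]
  [free : Module.Free Cb carrier]
  [fin : Module.Finite Cb carrier]

attribute [instance] ABMod.grp ABMod.mod ABMod.act ABMod.free ABMod.fin

/-- A simple pole: `a M ⊆ b M`. -/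
def ABMod.HasSimplePole (M : ABMod) : Prop :=
  ∀ x : M.carrier, ∃ y : M.carrier, a x = b • y

/-- Regular: embeds in an (a,b)-module with a simple pole. -/
def ABMod.IsRegular (M : ABMod) : Prop :=
  ∃ N : ABMod, N.HasSimplePole ∧ Embeds M.carrier N.carrier

/-- Semi-simple: isomorphic to a submodule of a finite direct sum of regular (a,b)-modules of
rank 1. -/
def IsSemisimple (E : Type*) [AddCommGroup E] [Module Cb E] [ABAction E] : Prop :=
  ∃ (n : ℕ) (M : Fin n → ABMod),
    (∀ i, (M i).IsRegular ∧ Module.finrank Cb (M i).carrier = 1) ∧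
      Embeds E (∀ i, (M i).carrier)

/-- The semi-simple part of `E`: the submodule generated by the elements `x` for which the
submodule generated by `x` is semi-simple. -/
def semisimplePart (E : Type*) [AddCommGroup E] [Module Cb E] [ABAction E] : Sub E :=
  Sub.gen {x | IsSemisimple (Sub.gen {x}).mod}

/-! ### The rank one modules and Jordan–Hölder sequences -/

/-- The (a,b)-module `E_λ`, of rank 1 with a generator `e` such that `a e = λ b e`: the element
`S e` is represented by `S ∈ ℂ[[b]]`. -/
def RankOne (_ : ℂ) : Type := Cb

instance (l : ℂ) : AddCommGroup (RankOne l) := inferInstanceAs (AddCommGroup Cb)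

instance (l : ℂ) : Module Cb (RankOne l) := inferInstanceAs (Module Cb Cb)

theorem rankOne_smul (l : ℂ) (S T : Cb) :
    PowerSeries.C l * b * (S * T) + b ^ 2 * PowerSeries.derivative ℂ (S * T) =
      S * (PowerSeries.C l * b * T + b ^ 2 * PowerSeries.derivative ℂ T) +
        (b ^ 2 * PowerSeries.derivative ℂ S) * T := by
  rw [Derivation.leibniz, smul_eq_mul, smul_eq_mul]
  ring

instance instABActionRankOne (l : ℂ) : ABAction (RankOne l) where
  a := AddMonoidHom.mk'
    (fun S : Cb => PowerSeries.C l * b * S + b ^ 2 * PowerSeries.derivative ℂ S)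
    (fun S T : Cb => by
      change PowerSeries.C l * b * (S + T) + b ^ 2 * PowerSeries.derivative ℂ (S + T) = _ + _
      rw [map_add]
      ring)
  a_smul S T := rankOne_smul l S T

/-- `0 = F 0 ⊆ F 1 ⊆ … ⊆ F k = E` is a Jordan–Hölder sequence, with numbers `l`: the terms are
normal submodules of `E`, the successive quotients have rank 1, and the quotient of `F (j + 1)` by
`F j` is isomorphic to `E_(l j)`. The indices of `l` start at `0`. -/
structure IsJordanHolder {E : Type*} [AddCommGroup E] [Module Cb E] [ABAction E] {k : ℕ}
    (F : Fin (k + 1) → Sub E) (l : Fin k → ℂ) : Prop where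
  bot : (F 0).mod = ⊥
  top : (F (Fin.last k)).mod = ⊤
  le : ∀ j : Fin k, (F j.castSucc).mod ≤ (F j.succ).mod
  normal : ∀ j, (F j).IsNormal
  rank : ∀ j : Fin k,
    Module.finrank Cb ((F j.succ).mod ⧸ ((F j.castSucc).within (F j.succ)).mod) = 1
  iso : ∀ j : Fin k,
    Iso ((F j.succ).mod ⧸ ((F j.castSucc).within (F j.succ)).mod) (RankOne (l j))

/-! ### Asymptotic expansions and frescos -/

/-- The expansions `⊕_(0 ≤ j ≤ N) ℂ[[s]] s^(q-1) (log s)^j`, where `a` is the multiplication by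
`s` and `b` the primitive in `s` without constant. This is `⊕_j ℂ[[b]] e_j` with
`e_j = s^(q-1) (log s)^j`, and the family `S` represents `∑_j S_j e_j`. -/
def LogExpansion (_ : ℚ) (N : ℕ) : Type := Fin (N + 1) → Cb

instance (q : ℚ) (N : ℕ) : AddCommGroup (LogExpansion q N) :=
  inferInstanceAs (AddCommGroup (Fin (N + 1) → Cb))

instance (q : ℚ) (N : ℕ) : Module Cb (LogExpansion q N) :=
  inferInstanceAs (Module Cb (Fin (N + 1) → Cb))

instance (q : ℚ) (N : ℕ) : Module ℂ (LogExpansion q N) :=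
  inferInstanceAs (Module ℂ (Fin (N + 1) → Cb))

instance (q : ℚ) (N : ℕ) : IsScalarTower ℂ Cb (LogExpansion q N) :=
  inferInstanceAs (IsScalarTower ℂ Cb (Fin (N + 1) → Cb))

/-- The coefficient `S_j`, which is zero for `j > N`. -/
def LogExpansion.coeff {q : ℚ} {N : ℕ} (S : LogExpansion q N) (j : ℕ) : Cb :=
  if h : j < N + 1 then (show Fin (N + 1) → Cb from S) ⟨j, h⟩ else 0

theorem LogExpansion.coeff_add {q : ℚ} {N : ℕ} (S T : LogExpansion q N) (j : ℕ) :
    (S + T).coeff j = S.coeff j + T.coeff j := by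
  unfold LogExpansion.coeff
  split_ifs
  · rfl
  · simp

theorem LogExpansion.coeff_smul {q : ℚ} {N : ℕ} (U : Cb) (S : LogExpansion q N) (j : ℕ) :
    (U • S).coeff j = U * S.coeff j := by
  unfold LogExpansion.coeff
  split_ifs
  · rfl
  · simp

/-- The derivative of `s^q (log s)^j` is `q e_j + j e_(j-1)`, so that `a e_j = s^q (log s)^j` is
equal to `q b e_j + j b e_(j-1)`. Hence the coefficient of `e_j` in `a (∑_j S_j e_j)` is
`b² S_j' + q b S_j + (j + 1) b S_(j+1)`. -/
instance instABActionLogExpansion (q : ℚ) (N : ℕ) : ABAction (LogExpansion q N) where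
  a := AddMonoidHom.mk'
    (fun (S : LogExpansion q N) (j : Fin (N + 1)) =>
      b ^ 2 * PowerSeries.derivative ℂ (S.coeff j) +
        PowerSeries.C (q : ℂ) * b * S.coeff j +
        PowerSeries.C ((j : ℕ) + 1 : ℂ) * b * S.coeff (j + 1))
    (fun S T => by
      refine funext fun j => ?_
      rw [LogExpansion.coeff_add, LogExpansion.coeff_add, map_add]
      change _ = (_ : Cb) + (_ : Cb)
      ring)
  a_smul U S := by
    refine funext fun j => ?_
    have hj : S.coeff (j : ℕ) = (show Fin (N + 1) → Cb from S) j := by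
      unfold LogExpansion.coeff
      exact dif_pos j.2
    change b ^ 2 * PowerSeries.derivative ℂ ((U • S).coeff j) +
        PowerSeries.C (q : ℂ) * b * (U • S).coeff j +
        PowerSeries.C ((j : ℕ) + 1 : ℂ) * b * (U • S).coeff (j + 1) =
      U * (b ^ 2 * PowerSeries.derivative ℂ (S.coeff j) +
        PowerSeries.C (q : ℂ) * b * S.coeff j +
        PowerSeries.C ((j : ℕ) + 1 : ℂ) * b * S.coeff (j + 1)) +
      (b ^ 2 * PowerSeries.derivative ℂ U) * (show Fin (N + 1) → Cb from S) j
    rw [LogExpansion.coeff_smul, LogExpansion.coeff_smul, ← hj, Derivation.leibniz, smul_eq_mul,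
      smul_eq_mul]
    ring

/-- The direct sum of the modules of expansions with exponents in the finite set `Λ`. -/
abbrev Expansions (Λ : Finset ℚ) (N : ℕ) : Type := ∀ q : Λ, LogExpansion q N

/-- A fresco: a module isomorphic to the submodule generated by one vector-valued expansion `φ`,
for a finite set `Λ` of rational numbers in `]0, 1]`, a bound `N` for the powers of `log s`, and a
finite-dimensional complex vector space `V`. -/
def IsFresco (E : Type*) [AddCommGroup E] [Module Cb E] [ABAction E] : Prop :=
  ∃ (Λ : Finset ℚ) (N : ℕ) (V : Type) (_ : AddCommGroup V) (_ : Module ℂ V)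
    (_ : FiniteDimensional ℂ V) (φ : Expansions Λ N ⊗[ℂ] V),
    (∀ q ∈ Λ, 0 < q ∧ q ≤ 1) ∧ Iso E (Sub.gen {φ}).mod

end FormalAB

end

noncomputable section

namespace FormalAB

open PowerSeries (C coeff constantCoeff)

/-! ### Power series -/

/-! A normal submodule of rank 1 isomorphic to `E_ν` is the same thing as a primitive eigenvector:
`e ∉ bE` with `a e = ν b e`. The theorem therefore asks which `ν` have a primitive eigenvector.

Since a fresco is generated by one element, the cokernel of `a` on the finite-dimensional space `E /
bE` has dimension at most 1, and so does the kernel (`kerLeOne_of_generator`). This property passes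
to quotients along a Jordan–Hölder sequence (`IsStep.kerLeOne`) and to normal submodules
(`KerLeOne.sub`). Let `e` generate the copy of `E_l` in `E / F`, with preimage `F'` in `E`, and let
`x` be a primitive eigenvector of `E / F` with number `ν`. The kernel bound forces `x = w e + b y`
modulo `F`, with `w` a unit. Either `ν = l`, or `y` is a primitive eigenvector of `E / F'` with
number `ν - 1` (`IsStep.eq_or_primitive`). Iterating, `ν = l_j + j` for some `j` counted from 0.

Conversely, lifting an eigenvector from `E / F'` to `E / F` amounts to solving a first-order
equation in `ℂ[[b]]`, whose only obstruction is one resonant coefficient. If morphisms to rank one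
modules separate points, this coefficient vanishes (`IsStep.coeff_eq_zero_of_separated`), so in the
semi-simple case every `l_j + j` occurs.

Finally, `S_1(E)` is the saturation of the span of all eigenvectors (`semisimplePart_eq`). It is
semi-simple, normal, and has the same primitive eigenvectors as `E`. Thus the numbers of `E` are
exactly the `mu_i + i`, and each of them is some `lam_j + j`. -/

theorem derivative_b_pow_mul (n : ℕ) :
    b ^ 2 * PowerSeries.derivative ℂ (b ^ n) = C (n : ℂ) * b ^ (n + 1) := by
  rcases n with - | n
  · simp
  · rw [Derivation.leibniz_pow, PowerSeries.derivative_X]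
    simp only [Nat.add_sub_cancel, nsmul_eq_mul, smul_eq_mul, map_natCast]
    ring

theorem isUnit_of_constantCoeff_ne_zero {S : Cb} (h : constantCoeff S ≠ 0) : IsUnit S :=
  PowerSeries.isUnit_iff_constantCoeff.2 h.isUnit

theorem exists_eq_C_add_b_mul (S : Cb) : ∃ T : Cb, S = C (constantCoeff S) + b * T :=
  ⟨_, by rw [add_comm]; exact PowerSeries.eq_X_mul_shift_add_const S⟩

theorem exists_eq_unit_mul_pow {S : Cb} (h : S ≠ 0) : ∃ (n : ℕ) (u : Cbˣ), S = u * b ^ n :=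
  IsDiscreteValuationRing.eq_unit_mul_pow_irreducible h PowerSeries.X_irreducible

/-- The equation `u' = h u` has a solution which is a unit. -/
theorem exists_unit_derivative_eq (h : Cb) :
    ∃ u : Cb, IsUnit u ∧ PowerSeries.derivative ℂ u = h * u := by
  set g : Cb := PowerSeries.mk fun n => coeff (n - 1) h / n with hg
  have hg0 : constantCoeff g = 0 := by
    rw [← PowerSeries.coeff_zero_eq_constantCoeff_apply]
    simp [hg]
  have hgd : PowerSeries.derivative ℂ g = h := by
    ext n
    rw [PowerSeries.coeff_derivative, hg, PowerSeries.coeff_mk]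
    have : (n : ℂ) + 1 ≠ 0 := Nat.cast_add_one_ne_zero n
    push_cast
    field_simp
  have hs : PowerSeries.HasSubst g := PowerSeries.HasSubst.of_constantCoeff_zero' hg0
  refine ⟨(PowerSeries.exp ℂ).subst g, ?_, ?_⟩
  · have h1 : PowerSeries.exp ℂ * (PowerSeries.evalNegHom (PowerSeries.exp ℂ)) = 1 :=
      PowerSeries.exp_mul_exp_neg_eq_one
    refine IsUnit.of_mul_eq_one ((PowerSeries.evalNegHom (PowerSeries.exp ℂ)).subst g) ?_
    rw [← PowerSeries.subst_mul hs, h1, ← PowerSeries.coe_substAlgHom hs, map_one]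
  · rw [PowerSeries.derivative_subst hs, PowerSeries.derivative_exp, hgd, mul_comm]

/-! ### Scalars

The `ℕ`- and `ℤ`-algebra structures of `ℂ[[b]]` found by unification are not those of an
arbitrary ring; these instances are needed by `module`. -/

instance natIsScalarTower (E : Type*) [AddCommGroup E] [Module Cb E] :
    @IsScalarTower ℕ Cb E Algebra.toSMul _ _ where
  smul_assoc n S x := by
    rw [Algebra.smul_def, mul_smul, eq_natCast, Nat.cast_smul_eq_nsmul]

instance intIsScalarTower (E : Type*) [AddCommGroup E] [Module Cb E] :
    @IsScalarTower ℤ Cb E Algebra.toSMul _ _ where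
  smul_assoc n S x := by
    rw [Algebra.smul_def, mul_smul, eq_intCast, Int.cast_smul_eq_zsmul]

/-! ### Reduction modulo `b` and saturated submodules -/

section

variable {E : Type*} [AddCommGroup E] [Module Cb E]

/-- The submodule `F + b E`. -/
def addB (F : Submodule Cb E) : Submodule Cb E :=
  F ⊔ LinearMap.range (b • (LinearMap.id : E →ₗ[Cb] E))

theorem mem_addB {F : Submodule Cb E} {x : E} : x ∈ addB F ↔ ∃ f ∈ F, ∃ y : E, x = f + b • y := by
  simp only [addB, Submodule.mem_sup, LinearMap.mem_range, LinearMap.smul_apply, LinearMap.id_apply]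
  constructor
  · rintro ⟨f, hf, _, ⟨y, rfl⟩, rfl⟩
    exact ⟨f, hf, y, rfl⟩
  · rintro ⟨f, hf, y, rfl⟩
    exact ⟨f, hf, _, ⟨y, rfl⟩, rfl⟩

theorem b_smul_mem_addB (F : Submodule Cb E) (y : E) : b • y ∈ addB F :=
  mem_addB.2 ⟨0, F.zero_mem, y, by simp⟩

theorem le_addB (F : Submodule Cb E) : F ≤ addB F := le_sup_left

theorem mem_addB_bot {x : E} : x ∈ addB (⊥ : Submodule Cb E) ↔ ∃ y : E, x = b • y := by
  simp [mem_addB]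

theorem mem_sup_span {F : Submodule Cb E} {e x : E} :
    x ∈ F ⊔ Cb ∙ e ↔ ∃ f ∈ F, ∃ S : Cb, x = f + S • e := by
  simp only [Submodule.mem_sup, Submodule.mem_span_singleton]
  constructor
  · rintro ⟨f, hf, _, ⟨y, rfl⟩, rfl⟩
    exact ⟨f, hf, y, rfl⟩
  · rintro ⟨f, hf, y, rfl⟩
    exact ⟨f, hf, _, ⟨y, rfl⟩, rfl⟩

theorem smul_mem_addB_iff {F : Submodule Cb E} {S : Cb} (hS : constantCoeff S ≠ 0) {x : E} :
    S • x ∈ addB F ↔ x ∈ addB F :=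
  Submodule.smul_mem_iff_of_isUnit _ (isUnit_of_constantCoeff_ne_zero hS)

theorem smul_mem_addB_of_constantCoeff {F : Submodule Cb E} {S : Cb} (hS : constantCoeff S = 0)
    (x : E) : S • x ∈ addB F := by
  obtain ⟨T, hT⟩ := exists_eq_C_add_b_mul S
  rw [hT, hS, map_zero, zero_add, mul_smul]
  exact b_smul_mem_addB F _

/-- `b x ∈ F` implies `x ∈ F`. -/
def IsSaturated (F : Submodule Cb E) : Prop := ∀ x : E, b • x ∈ F → x ∈ F

theorem IsSaturated.smul_mem {F : Submodule Cb E} (hF : IsSaturated F) {S : Cb} (hS : S ≠ 0) {x : E}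
    (hx : S • x ∈ F) : x ∈ F := by
  obtain ⟨n, u, rfl⟩ := exists_eq_unit_mul_pow hS
  rw [mul_smul, Submodule.smul_mem_iff_of_isUnit _ u.isUnit] at hx
  clear hS
  induction n with
  | zero => simpa using hx
  | succ n ih =>
    rw [pow_succ', mul_smul] at hx
    exact ih (hF _ hx)

theorem IsSaturated.mem_addB_of_b_smul {F : Submodule Cb E} (hF : IsSaturated F) {x y : E} {f : E} (hf : f ∈ F)
    (h : b • x = f + b ^ 2 • y) : x ∈ addB F := by
  have : x - b • y ∈ F := hF _ (by
    rw [show b • (x - b • y) = f by linear_combination (norm := module) h]; exact hf)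
  exact mem_addB.2 ⟨_, this, y, by module⟩

end

/-! ### Eigenvectors, characters and elementary steps -/

section

variable {E : Type*} [AddCommGroup E] [Module Cb E] [ABAction E]

/-- The set of all `e` such that `a e = ν b e` for some `ν ∈ ℂ`. -/
def eigenvectors (E : Type*) [AddCommGroup E] [Module Cb E] [ABAction E] : Set E :=
  {e | ∃ ν : ℂ, a e = (C ν * b) • e}

/-- `φ` is a morphism to `E_ν`, whose underlying `ℂ[[b]]`-module is `ℂ[[b]]`. -/
def IsCharacter (ν : ℂ) (φ : E →ₗ[Cb] Cb) : Prop :=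
  ∀ x, φ (a x) = C ν * b * φ x + b ^ 2 * PowerSeries.derivative ℂ (φ x)

theorem a_b_smul (x : E) : a (b • x) = b • a x + b ^ 2 • x := by
  rw [a_smul, PowerSeries.derivative_X, mul_one]

theorem a_b_pow_smul (n : ℕ) (x : E) :
    a (b ^ n • x) = b ^ n • a x + (C (n : ℂ) * b ^ (n + 1)) • x := by
  rw [a_smul, derivative_b_pow_mul]

theorem a_mem_addB {F : Submodule Cb E} (hF : ∀ x ∈ F, a x ∈ F) {x : E} (hx : x ∈ addB F) :
    a x ∈ addB F := by
  obtain ⟨f, hf, y, rfl⟩ := mem_addB.1 hx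
  rw [map_add, a_b_smul]
  exact mem_addB.2 ⟨a f, hF f hf, a y + b • y, by module⟩

/-- The kernel of `a` on `E / (F + b E)` has dimension at most 1. -/
def KerLeOne (F : Submodule Cb E) : Prop :=
  ∀ x y : E, a x ∈ addB F → a y ∈ addB F → x ∉ addB F → ∃ S : Cb, y - S • x ∈ addB F

/-- The quotient `E / F` contains a vector `e` with `a e = ν b e` which is not in `b (E / F)`. -/
def HasPrimitiveEigenvector (F : Submodule Cb E) (ν : ℂ) : Prop :=
  ∃ e, e ∉ addB F ∧ a e - (C ν * b) • e ∈ F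

/-- The characters of `E / F` separate the points. -/
def IsSeparated (F : Submodule Cb E) : Prop :=
  ∀ x ∉ F, ∃ (ν : ℂ) (φ : E →ₗ[Cb] Cb), IsCharacter ν φ ∧ (∀ f ∈ F, φ f = 0) ∧ φ x ≠ 0

variable {F F' : Submodule Cb E} {e : E} {l : ℂ}

/-- `F'` is obtained from `F` by adjoining a vector `e` which generates a copy of `E_l` in
`E / F`. -/
structure IsStep (F F' : Submodule Cb E) (e : E) (l : ℂ) : Prop where
  stable : ∀ x ∈ F, a x ∈ F
  sat : IsSaturated F
  sat' : IsSaturated F'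
  eq_sup : F' = F ⊔ Cb ∙ e
  eig : a e - (C l * b) • e ∈ F
  notMem : e ∉ F

/-! ### Eigenvectors, kernels and characters across one elementary step. -/

namespace IsStep

theorem mem (h : IsStep F F' e l) : e ∈ F' := by
  rw [h.eq_sup]
  exact mem_sup_span.2 ⟨0, F.zero_mem, 1, by simp⟩

theorem le (h : IsStep F F' e l) : F ≤ F' := by
  rw [h.eq_sup]
  exact le_sup_left

/-- If `e = f + b y`, saturation of `F'` gives `y = g + S e` with `g ∈ F`, so the unit `1 - b S`
carries `e` into `F`. -/
theorem notMem_addB (h : IsStep F F' e l) : e ∉ addB F := by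
  intro he
  obtain ⟨f, hf, y, hy⟩ := mem_addB.1 he
  have hy' : y ∈ F' := by
    refine h.sat' _ ?_
    rw [show b • y = e - f by rw [hy]; abel]
    exact F'.sub_mem h.mem (h.le hf)
  rw [h.eq_sup] at hy'
  obtain ⟨g, hg, S, rfl⟩ := mem_sup_span.1 hy'
  refine h.notMem ((Submodule.smul_mem_iff_of_isUnit F
    (r := (1 - b * S : Cb)) (isUnit_of_constantCoeff_ne_zero (by simp))).1 ?_)
  rw [show (1 - b * S : Cb) • e = f + b • g by
    linear_combination (norm := module) hy]
  exact F.add_mem hf (F.smul_mem _ hg)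

theorem a_mem (h : IsStep F F' e l) : a e ∈ addB F := by
  refine mem_addB.2 ⟨_, h.eig, C l • e, ?_⟩
  module

theorem mem_addB' (h : IsStep F F' e l) {x : E} :
    x ∈ addB F' ↔ ∃ S : Cb, x - S • e ∈ addB F := by
  rw [h.eq_sup]
  constructor
  · intro hx
    obtain ⟨f, hf, y, rfl⟩ := mem_addB.1 hx
    obtain ⟨g, hg, S, rfl⟩ := mem_sup_span.1 hf
    exact ⟨S, mem_addB.2 ⟨g, hg, y, by module⟩⟩
  · rintro ⟨S, hS⟩
    obtain ⟨f, hf, y, hy⟩ := mem_addB.1 hS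
    exact mem_addB.2 ⟨f + S • e, mem_sup_span.2 ⟨f, hf, S, rfl⟩, y, by
      linear_combination (norm := module) hy⟩

/-- The class of `e` is a nonzero element of the kernel of `a` on `E / (F + bE)`, hence spans it. -/
theorem mem_addB_of_kerLeOne (h : IsStep F F' e l) (hK : KerLeOne F) {x : E}
    (hx : a x ∈ addB F) : x ∈ addB F' :=
  h.mem_addB'.2 (hK e x h.a_mem hx h.notMem_addB)

/-- Modulo `F + bE`, both `a x` and `a y` are multiples of `e`, the first a nonzero one since `x ∉
F' + bE`. A combination `y - c x` is thus killed by `a` and lies in the line of `e`. -/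
theorem kerLeOne (h : IsStep F F' e l) (hK : KerLeOne F) : KerLeOne F' := by
  intro x y hx hy hxF
  obtain ⟨S, hS⟩ := h.mem_addB'.1 hx
  obtain ⟨T, hT⟩ := h.mem_addB'.1 hy
  have hS0 : constantCoeff S ≠ 0 := by
    intro h0
    refine hxF (h.mem_addB_of_kerLeOne hK ?_)
    have := (addB F).add_mem hS (smul_mem_addB_of_constantCoeff (F := F) h0 e)
    simpa using this
  set c : ℂ := constantCoeff T / constantCoeff S with hc
  refine ⟨C c, h.mem_addB_of_kerLeOne hK ?_⟩
  have h1 : constantCoeff (T - C c * S) = 0 := by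
    simp only [map_sub, map_mul, PowerSeries.constantCoeff_C, hc]
    field_simp
    simp
  have h2 : a (y - C c • x) = (a y - T • e) - C c • (a x - S • e) + (T - C c * S) • e := by
    rw [map_sub, a_smul, PowerSeries.derivative_C]
    module
  rw [h2]
  exact (addB F).add_mem ((addB F).sub_mem hT ((addB F).smul_mem _ hS))
    (smul_mem_addB_of_constantCoeff h1 e)

theorem eq_or_primitive (h : IsStep F F' e l) (hK : KerLeOne F) {ν : ℂ}
    (hν : HasPrimitiveEigenvector F ν) : ν = l ∨ HasPrimitiveEigenvector F' (ν - 1) := by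
  obtain ⟨x, hxF, hx⟩ := hν
  have hax : a x ∈ addB F := mem_addB.2 ⟨_, hx, C ν • x, by module⟩
  obtain ⟨w, hw⟩ := h.mem_addB'.1 (h.mem_addB_of_kerLeOne hK hax)
  have hw0 : constantCoeff w ≠ 0 := by
    intro h0
    have := (addB F).add_mem hw (smul_mem_addB_of_constantCoeff (F := F) h0 e)
    exact hxF (by simpa using this)
  obtain ⟨f, hf, y, hy⟩ := mem_addB.1 hw
  have hxy : x = f + w • e + b • y := by linear_combination (norm := module) hy
  have key : a x - (C ν * b) • x = (a f - (C ν * b) • f) + w • (a e - (C l * b) • e)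
      + (w * (C (l - ν) * b) + b ^ 2 * PowerSeries.derivative ℂ w) • e
      + b • (a y - (C (ν - 1) * b) • y) := by
    rw [hxy, map_add, map_add, a_smul, a_b_smul]
    simp only [map_sub, map_one]
    module
  have hfF : (a f - (C ν * b) • f) + w • (a e - (C l * b) • e) ∈ F :=
    F.add_mem (F.sub_mem (h.stable f hf) (F.smul_mem _ hf)) (F.smul_mem _ h.eig)
  by_cases hyF : y ∈ addB F'
  · left
    obtain ⟨S, hS⟩ := h.mem_addB'.1 hyF
    obtain ⟨g, hg, z, hz⟩ := mem_addB.1 hS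
    have hyz : y = g + S • e + b • z := by linear_combination (norm := module) hz
    by_contra hne
    have h3 : constantCoeff (w * C (l - ν)) ≠ 0 := by
      simpa using ⟨hw0, sub_ne_zero.2 (Ne.symm hne)⟩
    -- Modulo `F + b²E`, the relation `key` leaves only `b w (l - ν) e`. Dividing by `b` puts a unit
    -- multiple of `e` in `F + bE`.
    refine h.notMem_addB ((smul_mem_addB_iff h3).1 (h.sat.mem_addB_of_b_smul (x := _)
      (f := (a x - (C ν * b) • x) - ((a f - (C ν * b) • f) + w • (a e - (C l * b) • e))
        - b • (a g - (C (ν - 1) * b) • g) - b • S • (a e - (C l * b) • e))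
      (y := - (PowerSeries.derivative ℂ w • e
        + ((S * C l + b * PowerSeries.derivative ℂ S) • e + a z + b • z
          - C (ν - 1) • (S • e + b • z)))) ?_ ?_))
    · exact F.sub_mem (F.sub_mem (F.sub_mem hx hfF) (F.smul_mem _ (F.sub_mem (h.stable g hg)
        (F.smul_mem _ hg)))) (F.smul_mem _ (F.smul_mem _ h.eig))
    · rw [key, hyz, map_add, map_add, a_smul, a_b_smul]
      module
  · right
    refine ⟨y, hyF, h.sat' _ ?_⟩
    rw [show b • (a y - (C (ν - 1) * b) • y) = (a x - (C ν * b) • x)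
      - ((a f - (C ν * b) • f) + w • (a e - (C l * b) • e))
      - (w * (C (l - ν) * b) + b ^ 2 * PowerSeries.derivative ℂ w) • e by rw [key]; abel]
    exact F'.sub_mem (F'.sub_mem (h.le hx) (h.le hfF)) (F'.smul_mem _ h.mem)

/-- A character of `E / F` maps `e` to a multiple of `b ^ (l - ν)`. -/
theorem character_eq (h : IsStep F F' e l) {ν : ℂ} {φ : E →ₗ[Cb] Cb} (hφ : IsCharacter ν φ)
    (hF : ∀ f ∈ F, φ f = 0) :
    b * PowerSeries.derivative ℂ (φ e) = C (l - ν) * φ e := by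
  have h1 := hF _ h.eig
  rw [map_sub, hφ, map_smul, smul_eq_mul] at h1
  refine mul_left_cancel₀ PowerSeries.X_ne_zero (a := b) ?_
  rw [map_sub]
  linear_combination h1

/-- The combination `φ₀(e) φ - φ(e) φ₀` kills `e`. It is again a character, because `φ(e)` and
`φ₀(e)` are constant multiples of powers of `b` and a factor `b ^ n` lowers the number of a
character by `n`. -/
theorem isSeparated (h : IsStep F F' e l) (hP : IsSeparated F) : IsSeparated F' := by
  intro x hx
  obtain ⟨ν₀, φ₀, hφ₀, hφ₀F, hφ₀e⟩ := hP e h.notMem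
  have hy : φ₀ e • x - φ₀ x • e ∉ F := by
    intro hy
    refine hx (h.sat'.smul_mem hφ₀e ?_)
    have := F'.add_mem (h.le hy) (F'.smul_mem (φ₀ x) h.mem)
    simpa using this
  obtain ⟨ν, φ, hφ, hφF, hφy⟩ := hP _ hy
  have h0 := h.character_eq hφ₀ hφ₀F
  have h1 := h.character_eq hφ hφF
  refine ⟨ν + ν₀ - l, φ₀ e • φ - φ e • φ₀, ?_, ?_, ?_⟩
  · intro z
    simp only [LinearMap.sub_apply, LinearMap.smul_apply, smul_eq_mul, map_sub, map_add,
      Derivation.leibniz]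
    rw [hφ, hφ₀]
    rw [map_sub] at h0 h1
    linear_combination b * φ₀ z * h1 - b * φ z * h0
  · intro f hf
    rw [h.eq_sup] at hf
    obtain ⟨g, hg, S, rfl⟩ := mem_sup_span.1 hf
    simp only [LinearMap.sub_apply, LinearMap.smul_apply, smul_eq_mul, map_add, map_smul,
      hφF g hg, hφ₀F g hg]
    ring
  · rw [map_sub, map_smul, map_smul, smul_eq_mul, smul_eq_mul] at hφy
    rw [LinearMap.sub_apply, LinearMap.smul_apply, LinearMap.smul_apply, smul_eq_mul, smul_eq_mul]
    rwa [mul_comm (φ e)]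

/-- `b w' + m w = - u` is solvable if the coefficients of `u` at the resonances are zero. -/
theorem exists_solution (m : ℂ) (u : Cb) (hu : ∀ n : ℕ, m + n = 0 → coeff n u = 0) :
    ∃ w : Cb, u + C m * w + b * PowerSeries.derivative ℂ w = 0 := by
  -- At a resonance `m + n = 0` the division by zero yields 0, which is a valid choice as `coeff n u
  -- = 0` there.
  refine ⟨PowerSeries.mk fun n => - coeff n u / (m + n), ?_⟩
  ext n
  have h1 : coeff n (b * PowerSeries.derivative ℂ (PowerSeries.mk fun n => - coeff n u / (m + n)))
      = n * (- coeff n u / (m + n)) := by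
    rcases n with - | n
    · simp
    · rw [PowerSeries.coeff_succ_X_mul, PowerSeries.coeff_derivative, PowerSeries.coeff_mk]
      push_cast
      ring
  rw [map_add, map_add, h1, PowerSeries.coeff_C_mul, PowerSeries.coeff_mk, map_zero]
  by_cases h0 : m + n = 0
  · simp [hu n h0]
  · field_simp
    ring

/-- A character `φ` with number `ν₀` and `φ(e) ≠ 0` has `φ(e) = c b ^ m`, where `m = l - ν₀`. In the
image of the relation under `φ`, the coefficient of `b ^ (n + m)` is `c u_n` on one side and a
multiple of `l - ν + n = 0` on the other. -/
theorem coeff_eq_zero_of_separated (h : IsStep F F' e l) (hP : IsSeparated F) {ν : ℂ}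
    (hne : ν ≠ l) {z : E} {u : Cb} (hz : a z - (C (ν - 1) * b) • z - u • e ∈ F) (n : ℕ)
    (hn : l - ν + n = 0) : coeff n u = 0 := by
  obtain ⟨ν₀, φ, hφ, hφF, hφe⟩ := hP e h.notMem
  have h0 := h.character_eq hφ hφF
  obtain ⟨m, v, hv⟩ := exists_eq_unit_mul_pow hφe
  have hv0 : constantCoeff (v : Cb) ≠ 0 := (PowerSeries.isUnit_iff_constantCoeff.1 v.isUnit).ne_zero
  have hcoef : ∀ k : ℕ, (k : ℂ) * coeff k (φ e) = (l - ν₀) * coeff k (φ e) := by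
    intro k
    have := congrArg (coeff k) h0
    rw [PowerSeries.coeff_C_mul] at this
    rw [← this]
    rcases k with - | k
    · simp
    · rw [PowerSeries.coeff_succ_X_mul, PowerSeries.coeff_derivative]
      push_cast
      ring
  have hm0 : coeff m (φ e) ≠ 0 := by
    rw [hv, mul_comm]
    have := PowerSeries.coeff_X_pow_mul (v : Cb) m 0
    rw [zero_add] at this
    rw [this]
    simpa using hv0
  have hm : (m : ℂ) = l - ν₀ := mul_right_cancel₀ hm0 (hcoef m)
  have hp : φ e = b ^ m * C (coeff m (φ e)) := by
    ext k
    rw [mul_comm, PowerSeries.coeff_C_mul, PowerSeries.coeff_X_pow]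
    split_ifs with hk
    · rw [hk, mul_one]
    · rw [mul_zero]
      by_contra hk0
      exact hk (by exact_mod_cast (mul_right_cancel₀ hk0 (hcoef k)).trans hm.symm)
  have h1 := hφF _ hz
  rw [map_sub, map_sub, hφ, map_smul, map_smul, smul_eq_mul, smul_eq_mul, hp] at h1
  have h2 : b ^ m * (C (coeff m (φ e)) * u) =
      b * (C (ν₀ - ν + 1) * φ z + b * PowerSeries.derivative ℂ (φ z)) := by
    simp only [map_sub, map_add, map_one] at h1 ⊢
    linear_combination - h1
  have h3 := congrArg (coeff (n + m)) h2
  rw [PowerSeries.coeff_X_pow_mul, PowerSeries.coeff_C_mul] at h3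
  -- The right side of `h2` is divisible by `b`, so its coefficients are read at a positive index;
  -- index 0 would force `ν = l`.
  have hnm : n + m ≠ 0 := by
    intro h4
    obtain ⟨rfl, rfl⟩ : n = 0 ∧ m = 0 := by omega
    exact hne (by linear_combination - hn)
  obtain ⟨K, hK⟩ := Nat.exists_eq_succ_of_ne_zero hnm
  rw [hK, PowerSeries.coeff_succ_X_mul, map_add, PowerSeries.coeff_C_mul] at h3
  have h5 : coeff K (b * PowerSeries.derivative ℂ (φ z)) = K * coeff K (φ z) := by
    rcases K with - | K
    · simp
    · rw [PowerSeries.coeff_succ_X_mul, PowerSeries.coeff_derivative]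
      push_cast
      ring
  have hK' : (n : ℂ) + m = K + 1 := by exact_mod_cast hK
  have h6 : coeff m (φ e) * coeff n u = 0 := by
    rw [h3, h5]
    linear_combination (hn + hm - hK') * coeff K (φ z)
  exact (mul_eq_zero.1 h6).resolve_left hm0

/-- The lift is `b z + w e`, where `w` cancels the error term `u e`. The kernel bound makes `u` a
unit, hence `w` too, and the lift is primitive. -/
theorem primitive_of_primitive (h : IsStep F F' e l) (hK : KerLeOne F) (hP : IsSeparated F) {ν : ℂ}
    (hν : HasPrimitiveEigenvector F' (ν - 1)) (hne : ν ≠ l) : HasPrimitiveEigenvector F ν := by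
  obtain ⟨z, hzF, hz⟩ := hν
  have hz' := hz
  rw [h.eq_sup] at hz'
  obtain ⟨f, hf, u, hu⟩ := mem_sup_span.1 hz'
  have hzu : a z - (C (ν - 1) * b) • z - u • e ∈ F := by
    rw [hu]
    simpa using hf
  have hu0 : constantCoeff u ≠ 0 := by
    intro h0
    refine hzF (h.mem_addB_of_kerLeOne hK ?_)
    rw [show a z = (a z - (C (ν - 1) * b) • z - u • e) + u • e + b • (C (ν - 1) • z) by module]
    exact (addB F).add_mem ((addB F).add_mem (le_addB F hzu) (smul_mem_addB_of_constantCoeff h0 e))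
      (b_smul_mem_addB F _)
  obtain ⟨w, hw⟩ := exists_solution (l - ν) u (h.coeff_eq_zero_of_separated hP hne hzu)
  have hw0 : constantCoeff w ≠ 0 := by
    intro h0
    have := congrArg constantCoeff hw
    simp [h0] at this
    exact hu0 this
  refine ⟨b • z + w • e, ?_, ?_⟩
  · intro hmem
    refine h.notMem_addB ((smul_mem_addB_iff hw0).1 ?_)
    simpa using (addB F).sub_mem hmem (b_smul_mem_addB F z)
  · have : a (b • z + w • e) - (C ν * b) • (b • z + w • e) =
        b • (a z - (C (ν - 1) * b) • z - u • e) + w • (a e - (C l * b) • e)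
        + (b * (u + C (l - ν) * w + b * PowerSeries.derivative ℂ w)) • e := by
      rw [map_add, a_b_smul, a_smul]
      simp only [map_sub, map_one]
      module
    rw [this, hw, mul_zero, zero_smul, add_zero]
    exact F.add_mem (F.smul_mem _ hzu) (F.smul_mem _ h.eig)

end IsStep

theorem rankOne_a (l : ℂ) (S : Cb) :
    a (show RankOne l from S) =
      (show RankOne l from C l * b * S + b ^ 2 * PowerSeries.derivative ℂ S) := rfl

/-! ### Jordan–Hölder sequences as sequences of elementary steps -/

/-- The steps of a Jordan–Hölder sequence, with generators of the successive quotients. -/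
structure IsFlag {k : ℕ} (F : Fin (k + 1) → Submodule Cb E) (e : Fin k → E) (l : Fin k → ℂ) :
    Prop where
  bot : F 0 = ⊥
  top : F (Fin.last k) = ⊤
  step : ∀ j : Fin k, IsStep (F j.castSucc) (F j.succ) (e j) (l j)

theorem exists_generator {F G : Sub E} (hle : F.mod ≤ G.mod) {l : ℂ}
    (h : Iso (G.mod ⧸ (F.within G).mod) (RankOne l)) :
    ∃ e ∈ G.mod, e ∉ F.mod ∧ a e - (C l * b) • e ∈ F.mod ∧ G.mod = F.mod ⊔ Cb ∙ e ∧
      ∀ x ∈ G.mod, b • x ∈ F.mod → x ∈ F.mod := by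
  obtain ⟨f, hf⟩ := h
  have hmem : ∀ x : G.mod, f (Submodule.Quotient.mk x) = 0 ↔ (x : E) ∈ F.mod := by
    intro x
    rw [map_eq_zero_iff f f.injective, Submodule.Quotient.mk_eq_zero]
    rfl
  obtain ⟨q, hq⟩ := f.surjective (show RankOne l from (1 : Cb))
  obtain ⟨e, rfl⟩ := Submodule.Quotient.mk_surjective _ q
  have hS : ∀ S : Cb, f (Submodule.Quotient.mk (S • e)) = (show RankOne l from S) := by
    intro S
    rw [Submodule.Quotient.mk_smul, map_smul, hq]
    exact mul_one S
  refine ⟨e, e.2, ?_, ?_, ?_, ?_⟩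
  · rw [← hmem, hq]
    exact one_ne_zero (α := Cb)
  · have h1 : f (Submodule.Quotient.mk (a e)) = (show RankOne l from C l * b) := by
      refine (hf (Submodule.Quotient.mk e)).trans ?_
      rw [hq, rankOne_a, Derivation.map_one_eq_zero, mul_zero, add_zero, mul_one]
    refine (hmem (a e - (C l * b) • e)).1 ?_
    rw [Submodule.Quotient.mk_sub, map_sub, h1, hS, sub_self]
  · refine le_antisymm (fun x hx => ?_) (sup_le hle ?_)
    · refine mem_sup_span.2 ⟨x - (show Cb from f (Submodule.Quotient.mk ⟨x, hx⟩)) • (e : E), ?_,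
        _, (sub_add_cancel _ _).symm⟩
      refine (hmem (⟨x, hx⟩ - (show Cb from f (Submodule.Quotient.mk ⟨x, hx⟩)) • e)).1 ?_
      rw [Submodule.Quotient.mk_sub, map_sub, hS, sub_self]
    · rw [Submodule.span_singleton_le_iff_mem]
      exact e.2
  · intro x hx hbx
    refine (hmem ⟨x, hx⟩).1 ?_
    have h1 := (hmem (b • ⟨x, hx⟩)).2 hbx
    rw [Submodule.Quotient.mk_smul, map_smul] at h1
    exact (mul_eq_zero.1 (show (b : Cb) * (show Cb from f (Submodule.Quotient.mk ⟨x, hx⟩)) = 0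
      from h1)).resolve_left PowerSeries.X_ne_zero

/-- The quotients have no `b`-torsion, so an element killed by `b` descends through all terms to 0.
Once `E` has no `b`-torsion, normality gives saturation. -/
theorem IsJordanHolder.exists_isFlag {k : ℕ} {F : Fin (k + 1) → Sub E} {l : Fin k → ℂ}
    (h : IsJordanHolder F l) :
    (∀ x : E, b • x = 0 → x = 0) ∧ ∃ e, IsFlag (fun j => (F j).mod) e l := by
  choose e heG heF hea hsup hsat using fun j => exists_generator (h.le j) (h.iso j)
  have hb : ∀ x : E, b • x = 0 → x = 0 := by
    intro x hx
    have hj : ∀ j, x ∈ (F j).mod := by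
      intro j
      induction j using Fin.reverseInduction with
      | last => rw [h.top]; trivial
      | cast i hi =>
        refine hsat i x hi ?_
        rw [hx]
        exact Submodule.zero_mem _
    have := hj 0
    rw [h.bot] at this
    exact this
  have hF : ∀ j, IsSaturated (F j).mod := by
    intro j x hx
    obtain ⟨y, hy, hxy⟩ := (h.normal j _).1 ⟨hx, x, rfl⟩
    have : x - y = 0 := hb _ (by rw [smul_sub, hxy, sub_self])
    rwa [sub_eq_zero.1 this]
  exact ⟨hb, e, h.bot, h.top, fun j =>
    ⟨(F _).a_mem, hF _, hF _, hsup j, hea j, heF j⟩⟩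

/-! ### Induction along a Jordan–Hölder sequence. -/

namespace IsFlag

variable {k : ℕ} {F : Fin (k + 1) → Submodule Cb E} {e : Fin k → E} {l : Fin k → ℂ}

theorem finite (h : IsFlag F e l) : Module.Finite Cb E := by
  have : ∀ j, (F j).FG := by
    intro j
    induction j using Fin.induction with
    | zero => rw [h.bot]; exact Submodule.fg_bot
    | succ i hi =>
      rw [(h.step i).eq_sup]
      exact hi.sup (Submodule.fg_span_singleton _)
  exact ⟨h.top ▸ this _⟩

theorem kerLeOne (h : IsFlag F e l) (hK : KerLeOne (⊥ : Submodule Cb E)) (j : Fin (k + 1)) :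
    KerLeOne (F j) := by
  induction j using Fin.induction with
  | zero => rwa [h.bot]
  | succ i hi => exact (h.step i).kerLeOne hi

theorem isSeparated (h : IsFlag F e l) (hP : IsSeparated (⊥ : Submodule Cb E)) (j : Fin (k + 1)) :
    IsSeparated (F j) := by
  induction j using Fin.induction with
  | zero => rwa [h.bot]
  | succ i hi => exact (h.step i).isSeparated hi

theorem not_primitive_last (h : IsFlag F e l) (ν : ℂ) :
    ¬ HasPrimitiveEigenvector (F (Fin.last k)) ν := by
  rintro ⟨x, hx, -⟩
  refine hx (le_addB _ ?_)
  rw [h.top]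
  trivial

theorem exists_eq_of_primitive (h : IsFlag F e l) (hK : KerLeOne (⊥ : Submodule Cb E)) {ν : ℂ}
    (hν : HasPrimitiveEigenvector (⊥ : Submodule Cb E) ν) : ∃ j : Fin k, ν = l j + (j : ℕ) := by
  have key : ∀ j : Fin (k + 1), HasPrimitiveEigenvector (F j) (ν - (j : ℕ)) →
      ∃ i : Fin k, ν = l i + (i : ℕ) := by
    intro j
    induction j using Fin.reverseInduction with
    | last => exact fun h1 => (h.not_primitive_last _ h1).elim
    | cast i ih =>
      intro h1
      rcases (h.step i).eq_or_primitive (h.kerLeOne hK _) h1 with h2 | h2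
      · exact ⟨i, by rw [← h2]; simp⟩
      · refine ih ?_
        convert h2 using 1
        simp
        ring
  refine key 0 ?_
  rw [h.bot]
  simpa using hν

theorem primitive (h : IsFlag F e l) (hK : KerLeOne (⊥ : Submodule Cb E))
    (hP : IsSeparated (⊥ : Submodule Cb E)) (i : Fin k) :
    HasPrimitiveEigenvector (⊥ : Submodule Cb E) (l i + (i : ℕ)) := by
  have key : ∀ j : Fin (k + 1), (j : ℕ) ≤ i →
      HasPrimitiveEigenvector (F j) (l i + (i : ℕ) - (j : ℕ)) := by
    intro j
    induction j using Fin.reverseInduction with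
    | last =>
      intro h1
      simp at h1
      omega
    | cast n ih =>
      intro h1
      -- If the number sought is already `l n`, the generator `e n` serves. Otherwise `n < i`, and
      -- the eigenvector lifts from the next quotient.
      by_cases h2 : l i + (i : ℕ) - (n : ℕ) = l n
      · exact ⟨e n, (h.step n).notMem_addB, by
          rw [Fin.val_castSucc, h2]
          exact (h.step n).eig⟩
      · refine (h.step n).primitive_of_primitive (h.kerLeOne hK _) (h.isSeparated hP _) ?_ h2
        have h3 : (n : ℕ) ≠ i := by
          intro h3
          obtain rfl := Fin.ext h3
          exact h2 (by ring)
        have h4 : (n : ℕ) ≤ i := h1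
        have := ih (by rw [Fin.val_succ]; omega)
        convert this using 1
        simp
        ring
  have := key 0 (Nat.zero_le _)
  rw [h.bot] at this
  simpa using this

/-- The operator `a` is nilpotent modulo `b`. -/
theorem constantCoeff_eq_zero (h : IsFlag F e l) {x : E} {g : Cb} (hg : a x = g • x)
    (hx : x ∉ addB (⊥ : Submodule Cb E)) : constantCoeff g = 0 := by
  by_contra h0
  -- `a` sends `F (i + 1) + bE` into `F i + bE`, while on `x` it acts as a unit: `x` descends to
  -- `bE`.
  have key : ∀ j, x ∈ addB (F j) := by
    intro j
    induction j using Fin.reverseInduction with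
    | last =>
      refine le_addB _ ?_
      rw [h.top]
      trivial
    | cast i ih =>
      obtain ⟨S, hS⟩ := (h.step i).mem_addB'.1 ih
      refine (smul_mem_addB_iff h0).1 ?_
      rw [← hg]
      have h1 := a_mem_addB (h.step i).stable hS
      rw [map_sub, a_smul] at h1
      have h2 := (addB (F i.castSucc)).add_mem h1 ((addB (F i.castSucc)).add_mem
        ((addB (F i.castSucc)).smul_mem S (h.step i).a_mem)
        (b_smul_mem_addB (F i.castSucc) ((b * PowerSeries.derivative ℂ S) • e i)))
      convert h2 using 1
      module
  exact hx (h.bot ▸ key 0)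

end IsFlag

/-! ### Monogenic modules -/

theorem Sub.subset_gen (s : Set E) : s ⊆ (Sub.gen s).mod := fun x hx => by
  refine Submodule.mem_sInf.2 ?_
  exact fun P hP => hP.1 hx

theorem Sub.gen_le {s : Set E} {F : Sub E} (h : s ⊆ F.mod) : (Sub.gen s).mod ≤ F.mod :=
  sInf_le ⟨h, F.a_mem⟩

theorem exists_generator_mod {W : Type*} [AddCommGroup W] [Module Cb W] [ABAction W] {w : W}
    (h : Iso E (Sub.gen {w}).mod) :
    ∃ x : E, ∀ y, ∃ (S : Cb) (z t : E), y = S • x + a z + b • t := by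
  obtain ⟨f, hf⟩ := h
  set w' : (Sub.gen {w}).mod := ⟨w, Sub.subset_gen _ rfl⟩ with hw'
  -- With `M` the submodule generated by `w`, this is `ℂ[[b]] w + a M + b M`. It is stable under `a`
  -- and contains `w`, hence contains `M`.
  let P : Sub W :=
    { mod :=
        { carrier := {y | ∃ (S : Cb) (z t : (Sub.gen {w}).mod), y = S • w + a (z : W) + b • (t : W)}
          add_mem' := by
            rintro _ _ ⟨S, z, t, rfl⟩ ⟨S', z', t', rfl⟩
            refine ⟨S + S', z + z', t + t', ?_⟩
            push_cast
            rw [map_add]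
            module
          zero_mem' := ⟨0, 0, 0, by simp⟩
          smul_mem' := by
            rintro T _ ⟨S, z, t, rfl⟩
            refine ⟨T * S, T • z, T • t - (b * PowerSeries.derivative ℂ T) • z, ?_⟩
            push_cast
            rw [a_smul]
            module }
      a_mem := by
        rintro _ ⟨S, z, t, rfl⟩
        exact ⟨0, S • w' + a z + b • t, 0, by simp; rfl⟩ }
  have hP : (Sub.gen {w}).mod ≤ P.mod := Sub.gen_le (by
    rintro _ rfl
    exact ⟨1, 0, 0, by simp⟩)
  refine ⟨f.symm w', fun y => ?_⟩
  obtain ⟨S, z, t, hy⟩ := hP (f y).2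
  refine ⟨S, f.symm z, f.symm t, f.injective ?_⟩
  rw [map_add, map_add, map_smul, map_smul, hf, f.apply_symm_apply, f.apply_symm_apply,
    f.apply_symm_apply]
  exact Subtype.ext hy

/-- The class of `x` spans the cokernel of the `ℂ`-linear endomorphism of `E / bE` induced by `a`.
In finite dimension, kernel and cokernel have equal dimension. -/
theorem kerLeOne_of_generator [Module.Finite Cb E] {x : E}
    (hx : ∀ y, ∃ (S : Cb) (z t : E), y = S • x + a z + b • t) :
    KerLeOne (⊥ : Submodule Cb E) := by
  let B : Submodule Cb E := addB ⊥
  let _ : Module ℂ (E ⧸ B) := Module.compHom (E ⧸ B) (C : ℂ →+* Cb)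
  have hsm : ∀ (S : Cb) (v : E ⧸ B), S • v = constantCoeff S • v := by
    intro S v
    change S • v = C (constantCoeff S) • v
    obtain ⟨y, rfl⟩ := Submodule.Quotient.mk_surjective _ v
    rw [← Submodule.Quotient.mk_smul, ← Submodule.Quotient.mk_smul, Submodule.Quotient.eq,
      ← sub_smul]
    exact smul_mem_addB_of_constantCoeff (by simp) y
  have : Module.Finite ℂ (E ⧸ B) := by
    obtain ⟨s, hs⟩ := Module.Finite.fg_top (R := Cb) (M := E ⧸ B)
    refine ⟨s, ?_⟩
    rw [eq_top_iff]
    intro v _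
    have hv : v ∈ Submodule.span Cb (s : Set (E ⧸ B)) := hs ▸ Submodule.mem_top
    induction hv using Submodule.span_induction with
    | mem v hv => exact Submodule.subset_span hv
    | zero => exact Submodule.zero_mem _
    | add v w _ _ hv hw => exact Submodule.add_mem _ (hv trivial) (hw trivial)
    | smul S v _ hv =>
      rw [hsm]
      exact Submodule.smul_mem _ _ (hv trivial)
  let T : (E ⧸ B) →ₗ[ℂ] (E ⧸ B) :=
    { toFun := QuotientAddGroup.map B.toAddSubgroup B.toAddSubgroup a
        (fun y hy => a_mem_addB (fun z hz => by
          rw [Submodule.mem_bot] at hz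
          rw [hz, map_zero]
          exact Submodule.zero_mem _) hy)
      map_add' := map_add _
      map_smul' := by
        intro c v
        obtain ⟨y, rfl⟩ := Submodule.Quotient.mk_surjective _ v
        change Submodule.Quotient.mk (a (C c • y)) = (Submodule.Quotient.mk (C c • a y) : E ⧸ B)
        rw [a_smul, PowerSeries.derivative_C, mul_zero, zero_smul, add_zero] }
  have hT : ∀ y : E, T (Submodule.Quotient.mk y) = Submodule.Quotient.mk (a y) := fun _ => rfl
  have hq : Module.finrank ℂ ((E ⧸ B) ⧸ LinearMap.range T) ≤ 1 := by
    refine finrank_le_one (Submodule.Quotient.mk (Submodule.Quotient.mk x)) fun v => ?_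
    obtain ⟨v, rfl⟩ := Submodule.Quotient.mk_surjective _ v
    obtain ⟨y, rfl⟩ := Submodule.Quotient.mk_surjective _ v
    obtain ⟨S, z, t, rfl⟩ := hx y
    refine ⟨constantCoeff S, ?_⟩
    rw [← Submodule.Quotient.mk_smul, ← hsm, ← Submodule.Quotient.mk_smul, Submodule.Quotient.eq]
    refine ⟨Submodule.Quotient.mk (-z), ?_⟩
    rw [hT, ← Submodule.Quotient.mk_sub, Submodule.Quotient.eq]
    rw [map_neg]
    convert b_smul_mem_addB (⊥ : Submodule Cb E) t using 1
    module
  have hk : Module.finrank ℂ (LinearMap.ker T) ≤ 1 := by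
    have h1 := LinearMap.finrank_range_add_finrank_ker T
    have h2 := Submodule.finrank_quotient_add_finrank (LinearMap.range T)
    omega
  obtain ⟨v, hv⟩ := finrank_le_one_iff.1 hk
  intro y z hy hz hyB
  have hker : ∀ y : E, a y ∈ addB (⊥ : Submodule Cb E) →
      (Submodule.Quotient.mk y : E ⧸ B) ∈ LinearMap.ker T := by
    intro y hy
    rw [LinearMap.mem_ker, hT, Submodule.Quotient.mk_eq_zero]
    exact hy
  obtain ⟨c, hc⟩ := hv ⟨_, hker y hy⟩
  obtain ⟨d, hd⟩ := hv ⟨_, hker z hz⟩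
  have hc0 : c ≠ 0 := by
    rintro rfl
    rw [zero_smul] at hc
    exact hyB ((Submodule.Quotient.mk_eq_zero _).1 (congrArg Subtype.val hc).symm)
  refine ⟨C (d / c), (Submodule.Quotient.eq B).1 ?_⟩
  have hc' : c • (v : E ⧸ B) = Submodule.Quotient.mk y := congrArg Subtype.val hc
  have hd' : d • (v : E ⧸ B) = Submodule.Quotient.mk z := congrArg Subtype.val hd
  rw [← hd', Submodule.Quotient.mk_smul, hsm, PowerSeries.constantCoeff_C, ← hc', smul_smul,
    div_mul_cancel₀ _ hc0]

/-! ### Modules of rank one -/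

/-- Write `g = c b + b² t`; a unit `u` with `u' = -t u` removes the term `b² t`. -/
theorem exists_isUnit_smul_eigenvector {e : E} {g : Cb} (hg : a e = g • e)
    (hg0 : constantCoeff g = 0) :
    ∃ (ν : ℂ) (u : Cb), IsUnit u ∧ a (u • e) = (C ν * b) • u • e := by
  obtain ⟨h, rfl⟩ := PowerSeries.X_dvd_iff.2 hg0
  obtain ⟨t, ht⟩ := exists_eq_C_add_b_mul h
  obtain ⟨u, hu, hd⟩ := exists_unit_derivative_eq (-t)
  refine ⟨constantCoeff h, u, hu, ?_⟩
  rw [a_smul, hg, hd]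
  generalize constantCoeff h = c at ht
  rw [ht]
  module

theorem iso_rankOne_of_generator {e : E} {ν : ℂ} (he : a e = (C ν * b) • e)
    (hinj : ∀ S : Cb, S • e = 0 → S = 0) (hsurj : ∀ x : E, ∃ S : Cb, S • e = x) :
    ∃ f : E ≃ₗ[Cb] RankOne ν, ∀ x, f (a x) = a (f x) := by
  let g : RankOne ν ≃ₗ[Cb] E := LinearEquiv.ofBijective
    (show RankOne ν →ₗ[Cb] E from LinearMap.toSpanSingleton Cb E e)
    ⟨(injective_iff_map_eq_zero (LinearMap.toSpanSingleton Cb E e)).2 hinj, hsurj⟩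
  have hg : ∀ S : Cb, g (show RankOne ν from S) = S • e := fun S => rfl
  have hga : ∀ y, g (a y) = a (g y) := by
    intro (y : Cb)
    rw [rankOne_a, hg, hg, a_smul, he]
    module
  refine ⟨g.symm, fun x => g.injective ?_⟩
  rw [hga, g.apply_symm_apply, g.apply_symm_apply]

theorem ABMod.IsRegular.exists_iso {M : ABMod} (hM : M.IsRegular)
    (h1 : Module.finrank Cb M.carrier = 1) : ∃ ν : ℂ, Iso M.carrier (RankOne ν) := by
  obtain ⟨e, he0, he⟩ := finrank_eq_one_iff'.1 h1
  have hinj : ∀ S : Cb, S • e = 0 → S = 0 := fun S hS => (smul_eq_zero.1 hS).resolve_right he0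
  obtain ⟨g, hg⟩ := he (a e)
  have hg0 : constantCoeff g = 0 := by
    by_contra hg0
    obtain ⟨N, hN, f, hf, hfa⟩ := hM
    have hu := isUnit_of_constantCoeff_ne_zero hg0
    -- A simple pole gives `a (b ^ n N) ⊆ b ^ (n + 1) N`. If `g` were a unit, `f e` would lie in
    -- every `b ^ n N`, contradicting Krull's intersection theorem.
    have key : ∀ n : ℕ, ∃ y : N.carrier, f e = b ^ n • y := by
      intro n
      induction n with
      | zero => exact ⟨f e, by simp⟩
      | succ n ih =>
        obtain ⟨y, hy⟩ := ih
        obtain ⟨z, hz⟩ := hN y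
        obtain ⟨u, hu⟩ := hu
        refine ⟨(↑u⁻¹ : Cb) • (z + C (n : ℂ) • y), ?_⟩
        have h2 : g • f e = b ^ (n + 1) • (z + C (n : ℂ) • y) := by
          rw [← map_smul, hg, hfa, hy, a_b_pow_smul, hz]
          module
        rw [smul_comm, ← h2, ← hu, smul_smul, Units.inv_mul, one_smul]
    have hI : (Ideal.span {b} : Ideal Cb) ≠ ⊤ := by
      rw [Ne, Ideal.span_singleton_eq_top]
      exact PowerSeries.X_irreducible.not_isUnit
    have h0 := Ideal.iInf_pow_smul_eq_bot_of_isLocalRing (M := N.carrier) (Ideal.span {b}) hI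
    have hfe : f e ∈ (⊥ : Submodule Cb N.carrier) := by
      rw [← h0, Submodule.mem_iInf]
      intro n
      obtain ⟨y, hy⟩ := key n
      rw [hy]
      exact Submodule.smul_mem_smul (Ideal.pow_mem_pow (Ideal.mem_span_singleton_self b) n) trivial
    rw [Submodule.mem_bot] at hfe
    exact he0 (hf (by rw [hfe, map_zero]))
  obtain ⟨ν, u, hu, hν⟩ := exists_isUnit_smul_eigenvector hg.symm hg0
  refine ⟨ν, iso_rankOne_of_generator hν (fun S hS => ?_) fun x => ?_⟩
  · rw [smul_smul] at hS
    exact (mul_eq_zero.1 (hinj _ hS)).resolve_right hu.ne_zero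
  · obtain ⟨S, rfl⟩ := he x
    obtain ⟨u, rfl⟩ := hu
    exact ⟨S * ↑u⁻¹, by rw [smul_smul, mul_assoc, Units.inv_mul, mul_one]⟩

instance (l : ℂ) : Module.Free Cb (RankOne l) := inferInstanceAs (Module.Free Cb Cb)

instance (l : ℂ) : Module.Finite Cb (RankOne l) := inferInstanceAs (Module.Finite Cb Cb)

/-- `E_l` as a bundled module. -/
def rankOneMod (l : ℂ) : ABMod where
  carrier := RankOne l

theorem finrank_rankOne (l : ℂ) : Module.finrank Cb (RankOne l) = 1 :=
  Module.finrank_self Cb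

theorem rankOneMod_isRegular (l : ℂ) : (rankOneMod l).IsRegular := by
  refine ⟨rankOneMod l, fun (x : Cb) =>
    ⟨(show Cb from C l * x + b * PowerSeries.derivative ℂ x), ?_⟩,
    LinearMap.id, Function.injective_id, fun _ => rfl⟩
  change (C l * b * x + b ^ 2 * PowerSeries.derivative ℂ x : Cb) =
    b * (C l * x + b * PowerSeries.derivative ℂ x)
  ring

/-! ### Semi-simple modules and characters -/

theorem isSemisimple_iff : IsSemisimple E ↔
    ∃ (n : ℕ) (ν : Fin n → ℂ) (φ : Fin n → E →ₗ[Cb] Cb),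
      (∀ i, IsCharacter (ν i) (φ i)) ∧ ∀ x, (∀ i, φ i x = 0) → x = 0 := by
  constructor
  · rintro ⟨n, M, hM, f, hf, hfa⟩
    choose ν g hg using fun i => (hM i).1.exists_iso (hM i).2
    refine ⟨n, ν, fun i => (g i).toLinearMap ∘ₗ LinearMap.proj i ∘ₗ f, fun i x => ?_,
      fun x hx => hf ?_⟩
    · have h1 : f (a x) i = a (f x i) := congrFun (hfa x) i
      change g i (f (a x) i) = _
      rw [h1, hg]
      rfl
    · rw [map_zero]
      funext i
      exact (g i).map_eq_zero_iff.1 (hx i)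
  · rintro ⟨n, ν, φ, hφ, hinj⟩
    refine ⟨n, fun i => rankOneMod (ν i), fun i => ⟨rankOneMod_isRegular _, finrank_rankOne _⟩,
      LinearMap.pi fun i => (show E →ₗ[Cb] RankOne (ν i) from φ i), ?_, ?_⟩
    · rw [injective_iff_map_eq_zero]
      exact fun x hx => hinj x fun i => congrFun hx i
    · intro x
      funext i
      exact hφ i x

/-- The submodule of the elements `x` such that `b ^ n x` is a combination of eigenvectors. -/
def eigenSaturation (E : Type*) [AddCommGroup E] [Module Cb E] [ABAction E] : Sub E where
  mod :=
    { carrier := {x | ∃ n : ℕ, b ^ n • x ∈ Submodule.span Cb (eigenvectors E)}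
      add_mem' := by
        rintro x y ⟨n, hn⟩ ⟨m, hm⟩
        refine ⟨n + m, ?_⟩
        rw [show b ^ (n + m) • (x + y) = b ^ m • b ^ n • x + b ^ n • b ^ m • y by module]
        exact Submodule.add_mem _ (Submodule.smul_mem _ _ hn) (Submodule.smul_mem _ _ hm)
      zero_mem' := ⟨0, by simp⟩
      smul_mem' := by
        rintro S x ⟨n, hn⟩
        refine ⟨n, ?_⟩
        rw [smul_comm]
        exact Submodule.smul_mem _ _ hn }
  a_mem := by
    have hspan : ∀ x ∈ Submodule.span Cb (eigenvectors E),
        a x ∈ Submodule.span Cb (eigenvectors E) := by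
      intro x hx
      induction hx using Submodule.span_induction with
      | mem x hx =>
        have hx' := hx
        obtain ⟨ν, hν⟩ := hx'
        rw [hν]
        exact Submodule.smul_mem _ _ (Submodule.subset_span hx)
      | zero => rw [map_zero]; exact Submodule.zero_mem _
      | add x y _ _ hx hy => rw [map_add]; exact Submodule.add_mem _ hx hy
      | smul S x hx hax =>
        rw [a_smul]
        exact Submodule.add_mem _ (Submodule.smul_mem _ _ hax) (Submodule.smul_mem _ _ hx)
    rintro x ⟨n, hn⟩
    refine ⟨n, ?_⟩
    have h1 := hspan _ hn
    rw [a_b_pow_smul] at h1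
    have h2 := Submodule.sub_mem _ h1 (Submodule.smul_mem _ (C (n : ℂ) * b) hn)
    convert h2 using 1
    module

theorem isSaturated_eigenSaturation : IsSaturated (eigenSaturation E).mod := by
  rintro x ⟨n, hn⟩
  refine ⟨n + 1, ?_⟩
  rwa [pow_succ, mul_smul]

theorem eigenvectors_subset_eigenSaturation : eigenvectors E ⊆ (eigenSaturation E).mod :=
  fun x hx => ⟨0, by simpa using Submodule.subset_span hx⟩

/-- For a minimal jointly injective family of characters there are vectors `y i`, dual to it up to
powers of `b`. They are eigenvectors, and their span contains a `b ^ M E`. -/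
theorem IsSemisimple.eigenSaturation_eq_top (h : IsSemisimple E) :
    (eigenSaturation E).mod = ⊤ := by
  obtain ⟨n, ν, φ, hφ, hinj⟩ := isSemisimple_iff.1 h
  obtain ⟨T, hT, hmin⟩ := exists_minimal_of_wellFoundedLT
    (fun T : Finset (Fin n) => ∀ x, (∀ i ∈ T, φ i x = 0) → x = 0)
    ⟨Finset.univ, fun x hx => hinj x fun i => hx i (Finset.mem_univ i)⟩
  have hex : ∀ i ∈ T, ∃ (y : E) (m : ℕ), φ i y = b ^ m ∧ ∀ j ∈ T, j ≠ i → φ j y = 0 := by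
    intro i hi
    have h1 : ¬ ∀ x, (∀ j ∈ T.erase i, φ j x = 0) → x = 0 := by
      intro h2
      exact Finset.notMem_erase i T (hmin h2 (Finset.erase_subset i T) hi)
    push Not at h1
    obtain ⟨x, hx, hx0⟩ := h1
    have hxi : φ i x ≠ 0 := by
      intro h2
      refine hx0 (hT x fun j hj => ?_)
      by_cases hji : j = i
      · rw [hji, h2]
      · exact hx j (Finset.mem_erase.2 ⟨hji, hj⟩)
    obtain ⟨m, u, hu⟩ := exists_eq_unit_mul_pow hxi
    refine ⟨(↑u⁻¹ : Cb) • x, m, ?_, fun j hj hji => ?_⟩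
    · rw [map_smul, hu, smul_eq_mul, Units.inv_mul_cancel_left]
    · rw [map_smul, hx j (Finset.mem_erase.2 ⟨hji, hj⟩), smul_zero]
  choose! y m hy hy0 using hex
  have heig : ∀ i ∈ T, y i ∈ eigenvectors E := by
    intro i hi
    -- In `E_ν`, the vector `b ^ m` is an eigenvector with number `ν + m`.
    refine ⟨ν i + m i, ?_⟩
    rw [← sub_eq_zero]
    refine hT _ fun j hj => ?_
    rw [map_sub, hφ, map_smul, smul_eq_mul]
    by_cases hji : j = i
    · subst hji
      rw [hy j hj, derivative_b_pow_mul, map_add]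
      ring
    · rw [hy0 i hi j hj hji]
      simp
  rw [eq_top_iff]
  intro x _
  set M := ∑ i ∈ T, m i with hM
  have hle : ∀ i ∈ T, m i ≤ M := fun i hi => Finset.single_le_sum (fun _ _ => Nat.zero_le _) hi
  refine ⟨M, ?_⟩
  have hx : b ^ M • x = ∑ i ∈ T, (b ^ (M - m i) * φ i x) • y i := by
    rw [← sub_eq_zero]
    refine hT _ fun j hj => ?_
    rw [map_sub, map_sum, map_smul, Finset.sum_eq_single j, map_smul, hy j hj, smul_eq_mul,
      smul_eq_mul, mul_right_comm, ← pow_add, Nat.sub_add_cancel (hle j hj), sub_self]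
    · intro i hi hij
      rw [map_smul, hy0 i hi j hj (Ne.symm hij), smul_zero]
    · exact fun h => (h hj).elim
  rw [hx]
  exact Submodule.sum_mem _ fun i hi => Submodule.smul_mem _ _ (Submodule.subset_span (heig i hi))

/-- Noetherianity gives both finitely many eigenvectors and an exponent independent of `x`. -/
theorem exists_pow_smul_mem [Module.Finite Cb E] (h : (eigenSaturation E).mod = ⊤) :
    ∃ (T : Finset E) (M : ℕ), (T : Set E) ⊆ eigenvectors E ∧
      ∀ x : E, b ^ M • x ∈ Submodule.span Cb (T : Set E) := by
  obtain ⟨T, hT, hspan⟩ := (Submodule.fg_span_iff_fg_span_finset_subset (eigenvectors E)).1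
    (IsNoetherian.noetherian (R := Cb) (Submodule.span Cb (eigenvectors E)))
  let N : ℕ →o Submodule Cb E :=
    { toFun := fun n => (Submodule.span Cb (eigenvectors E)).comap (b ^ n • LinearMap.id)
      monotone' := monotone_nat_of_le_succ fun n x hx => by
        change b ^ (n + 1) • x ∈ Submodule.span Cb (eigenvectors E)
        rw [pow_succ', mul_smul]
        exact Submodule.smul_mem _ _ hx }
  obtain ⟨M, hM⟩ := (monotone_stabilizes_iff_noetherian (R := Cb) (M := E)).2 inferInstance N
  refine ⟨T, M, hT, fun x => ?_⟩
  rw [← hspan]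
  have hx : x ∈ (eigenSaturation E).mod := h ▸ Submodule.mem_top
  obtain ⟨n, hn⟩ := hx
  have h1 : x ∈ N (M + n) := N.monotone (Nat.le_add_left n M) hn
  rw [← hM _ (Nat.le_add_right M n)] at h1
  exact h1

/-- A minimal finite set of eigenvectors whose span contains some `b ^ M E` is linearly independent.
The coordinates of `b ^ M x` are then characters in `x`, with numbers lowered by `M`, and they are
jointly injective. -/
theorem isSemisimple_of_eigenSaturation_eq_top [Module.Finite Cb E]
    (htf : IsSaturated (⊥ : Submodule Cb E)) (h : (eigenSaturation E).mod = ⊤) :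
    IsSemisimple E := by
  classical
  obtain ⟨T, ⟨M, hTe, hTM⟩, hmin⟩ := exists_minimal_of_wellFoundedLT
    (fun T : Finset E => ∃ M : ℕ, (T : Set E) ⊆ eigenvectors E ∧
      ∀ x : E, b ^ M • x ∈ Submodule.span Cb (T : Set E)) (exists_pow_smul_mem h)
  have hli : LinearIndependent Cb ((↑) : T → E) := by
    rw [Fintype.linearIndependent_iff]
    intro g hg i
    by_contra hgi
    obtain ⟨n, u, hu⟩ := exists_eq_unit_mul_pow hgi
    -- A relation with coefficient `u b ^ n` at `i` puts `b ^ n i` in the span of the others, so `i`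
    -- can be dropped at the cost of the exponent `n + M`.
    refine Finset.notMem_erase (i : E) T (hmin ⟨n + M, ?_, ?_⟩ (Finset.erase_subset _ T) i.2)
    · exact fun x hx => hTe (Finset.erase_subset _ T hx)
    · have hi : b ^ n • (i : E) ∈ Submodule.span Cb ((T.erase i : Finset E) : Set E) := by
        rw [← Submodule.smul_mem_iff_of_isUnit _ u.isUnit, smul_smul, ← hu]
        rw [← Finset.add_sum_erase _ _ (Finset.mem_univ i)] at hg
        rw [eq_neg_of_add_eq_zero_left hg]
        refine Submodule.neg_mem _ (Submodule.sum_mem _ fun j hj => Submodule.smul_mem _ _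
          (Submodule.subset_span ?_))
        exact Finset.mem_erase.2 ⟨fun h => Finset.ne_of_mem_erase hj (Subtype.ext h), j.2⟩
      intro x
      rw [pow_add, mul_smul]
      have hx := hTM x
      generalize b ^ M • x = z at hx
      induction hx using Submodule.span_induction with
      | mem y hy =>
        by_cases hyi : y = i
        · rwa [hyi]
        · exact Submodule.smul_mem _ _ (Submodule.subset_span (Finset.mem_erase.2 ⟨hyi, hy⟩))
      | zero => rw [smul_zero]; exact Submodule.zero_mem _
      | add y z _ _ hy hz => rw [smul_add]; exact Submodule.add_mem _ hy hz
      | smul S y _ hy => rw [smul_comm]; exact Submodule.smul_mem _ _ hy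
  have hmem : ∀ x : E, b ^ M • x ∈ Submodule.span Cb (Set.range ((↑) : T → E)) := by
    intro x
    rw [Subtype.range_coe_subtype]
    exact hTM x
  choose ν hν using fun i : T => hTe i.2
  let c : E →ₗ[Cb] (T →₀ Cb) := hli.repr ∘ₗ
    (b ^ M • (LinearMap.id : E →ₗ[Cb] E)).codRestrict _ hmem
  have hc : ∀ x, ∑ i : T, c x i • (i : E) = b ^ M • x := by
    intro x
    have := hli.linearCombination_repr ⟨b ^ M • x, hmem x⟩
    rw [Finsupp.linearCombination_apply, Finsupp.sum_fintype _ _ (by simp)] at this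
    exact this
  have hca : ∀ x (i : T), c (a x) i =
      C (ν i - M) * b * c x i + b ^ 2 * PowerSeries.derivative ℂ (c x i) := by
    intro x i
    have h1 : ∑ i : T, (c (a x) i - (C (ν i - M) * b * c x i
        + b ^ 2 * PowerSeries.derivative ℂ (c x i))) • (i : E) = 0 := by
      have h2 : a (b ^ M • x) = ∑ i : T, (c x i * (C (ν i) * b)
          + b ^ 2 * PowerSeries.derivative ℂ (c x i)) • (i : E) := by
        rw [← hc, map_sum]
        refine Finset.sum_congr rfl fun i _ => ?_
        rw [a_smul, hν]
        module
      have h3 : b ^ M • a x = a (b ^ M • x) - (C (M : ℂ) * b) • b ^ M • x := by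
        rw [a_b_pow_smul]
        module
      rw [h2, ← hc, ← hc, Finset.smul_sum, ← sub_eq_zero, ← Finset.sum_sub_distrib,
        ← Finset.sum_sub_distrib] at h3
      rw [← h3]
      refine Finset.sum_congr rfl fun i _ => ?_
      rw [map_sub]
      module
    exact sub_eq_zero.1 (Fintype.linearIndependent_iff.1 hli _ h1 i)
  let σ := T.equivFin.symm
  refine isSemisimple_iff.2 ⟨T.card, fun i => ν (σ i) - M, fun i => Finsupp.lapply (σ i) ∘ₗ c,
    fun i x => hca x (σ i), fun x hx => ?_⟩
  refine (Submodule.mem_bot Cb).1 (htf.smul_mem (S := b ^ M) (pow_ne_zero _ PowerSeries.X_ne_zero)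
    ((Submodule.mem_bot Cb).2 ?_))
  rw [← hc]
  refine Finset.sum_eq_zero fun i _ => ?_
  have : c x i = 0 := by simpa using hx (σ.symm i)
  rw [this, zero_smul]

theorem IsSemisimple.of_embeds {W : Type*} [AddCommGroup W] [Module Cb W] [ABAction W]
    (hW : IsSemisimple W) (h : Embeds E W) : IsSemisimple E := by
  obtain ⟨n, M, hM, f, hf, hfa⟩ := hW
  obtain ⟨g, hg, hga⟩ := h
  exact ⟨n, M, hM, f ∘ₗ g, hf.comp hg, fun x => by
    rw [LinearMap.comp_apply, hga, hfa, LinearMap.comp_apply]⟩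

theorem IsSemisimple.isSeparated (h : IsSemisimple E) : IsSeparated (⊥ : Submodule Cb E) := by
  obtain ⟨n, ν, φ, hφ, hinj⟩ := isSemisimple_iff.1 h
  intro x hx
  have : ∃ i, φ i x ≠ 0 := by
    by_contra! h0
    exact hx ((Submodule.mem_bot Cb).2 (hinj x h0))
  obtain ⟨i, hi⟩ := this
  exact ⟨ν i, φ i, hφ i, by simp, hi⟩

theorem map_eigenSaturation_le {F : Sub E} {x : F.mod} (hx : x ∈ (eigenSaturation F.mod).mod) :
    (x : E) ∈ (eigenSaturation E).mod := by
  obtain ⟨n, hn⟩ := hx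
  refine ⟨n, ?_⟩
  have h1 := Submodule.mem_map_of_mem (f := F.mod.subtype) hn
  rw [Submodule.map_span] at h1
  refine Submodule.span_mono ?_ h1
  rintro _ ⟨y, ⟨ν, hν⟩, rfl⟩
  exact ⟨ν, congrArg Subtype.val hν⟩

theorem eigenSaturation_eigenSaturation :
    (eigenSaturation (eigenSaturation E).mod).mod = ⊤ := by
  rw [eq_top_iff]
  rintro x -
  obtain ⟨n, hn⟩ := x.2
  refine ⟨n, ?_⟩
  have h1 : Submodule.span Cb (eigenvectors E) ≤
      (Submodule.span Cb (eigenvectors (eigenSaturation E).mod)).map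
        (eigenSaturation E).mod.subtype := by
    rw [Submodule.span_le]
    intro y hy
    refine ⟨⟨y, eigenvectors_subset_eigenSaturation hy⟩, Submodule.subset_span ?_, rfl⟩
    obtain ⟨ν, hν⟩ := hy
    exact ⟨ν, Subtype.ext hν⟩
  obtain ⟨z, hz, hzx⟩ := h1 hn
  have : z = b ^ n • x := Subtype.ext hzx
  rwa [← this]

theorem isSemisimple_eigenSaturation [Module.Finite Cb E]
    (htf : IsSaturated (⊥ : Submodule Cb E)) : IsSemisimple (eigenSaturation E).mod := by
  refine isSemisimple_of_eigenSaturation_eq_top (fun x hx => ?_) eigenSaturation_eigenSaturation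
  rw [Submodule.mem_bot] at hx ⊢
  exact Subtype.ext ((Submodule.mem_bot Cb).1 (htf _
    ((Submodule.mem_bot Cb).2 (congrArg Subtype.val hx))))

/-- A semi-simple submodule is the saturation of its own eigenvectors, which are eigenvectors of
`E`. Conversely, the saturation is semi-simple, and so are its submodules. -/
theorem semisimplePart_mod_eq [Module.Finite Cb E] (htf : IsSaturated (⊥ : Submodule Cb E)) :
    (semisimplePart E).mod = (eigenSaturation E).mod := by
  refine le_antisymm (Sub.gen_le fun x hx => ?_) fun x hx => Sub.subset_gen _ ?_
  · have h1 := IsSemisimple.eigenSaturation_eq_top hx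
    have h2 : (⟨x, Sub.subset_gen _ rfl⟩ : (Sub.gen {x}).mod) ∈
        (eigenSaturation (Sub.gen {x}).mod).mod := h1 ▸ Submodule.mem_top
    exact map_eigenSaturation_le h2
  · have hle : (Sub.gen {x}).mod ≤ (eigenSaturation E).mod :=
      Sub.gen_le (Set.singleton_subset_iff.2 hx)
    exact (isSemisimple_eigenSaturation htf).of_embeds
      ⟨Submodule.inclusion hle, Submodule.inclusion_injective hle, fun _ => rfl⟩

theorem semisimplePart_eq [Module.Finite Cb E] (htf : IsSaturated (⊥ : Submodule Cb E)) :
    semisimplePart E = eigenSaturation E := by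
  have h := semisimplePart_mod_eq htf
  generalize semisimplePart E = F at h
  cases F
  subst h
  rfl

/-! ### Normal submodules -/

theorem mem_addB_bot_sub {F : Sub E} (hF : IsSaturated F.mod) (x : F.mod) :
    x ∈ addB (⊥ : Submodule Cb F.mod) ↔ (x : E) ∈ addB (⊥ : Submodule Cb E) := by
  rw [mem_addB_bot, mem_addB_bot]
  constructor
  · rintro ⟨y, rfl⟩
    exact ⟨y, rfl⟩
  · rintro ⟨y, hy⟩
    exact ⟨⟨y, hF y (hy ▸ x.2)⟩, Subtype.ext hy⟩

/-- For saturated `F`, the space `F / bF` embeds in `E / bE` compatibly with `a`. -/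
theorem KerLeOne.sub (hK : KerLeOne (⊥ : Submodule Cb E)) {F : Sub E} (hF : IsSaturated F.mod) :
    KerLeOne (⊥ : Submodule Cb F.mod) := by
  intro x y hx hy hxF
  rw [mem_addB_bot_sub hF] at hx hy hxF
  obtain ⟨S, hS⟩ := hK x y hx hy hxF
  exact ⟨S, (mem_addB_bot_sub hF _).2 hS⟩

theorem primitive_eigenSaturation_iff (ν : ℂ) :
    HasPrimitiveEigenvector (⊥ : Submodule Cb (eigenSaturation E).mod) ν ↔
      HasPrimitiveEigenvector (⊥ : Submodule Cb E) ν := by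
  constructor
  · rintro ⟨e, he, hν⟩
    rw [mem_addB_bot_sub isSaturated_eigenSaturation] at he
    refine ⟨e, he, ?_⟩
    rw [Submodule.mem_bot] at hν ⊢
    exact congrArg Subtype.val hν
  · rintro ⟨e, he, hν⟩
    rw [Submodule.mem_bot] at hν
    refine ⟨⟨e, eigenvectors_subset_eigenSaturation ⟨ν, sub_eq_zero.1 hν⟩⟩, ?_, ?_⟩
    · rwa [mem_addB_bot_sub isSaturated_eigenSaturation]
    · rw [Submodule.mem_bot]
      exact Subtype.ext hν

theorem notMem_addB_of_isNormal (htf : IsSaturated (⊥ : Submodule Cb E)) {L : Sub E}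
    (hL : L.IsNormal) {e : E} (heL : e ∈ L.mod) (he0 : e ≠ 0)
    (he : ∀ x ∈ L.mod, ∃ S : Cb, S • e = x) : e ∉ addB (⊥ : Submodule Cb E) := by
  intro h
  rw [mem_addB_bot] at h
  obtain ⟨y, hy, hey⟩ := (hL e).1 ⟨heL, h⟩
  obtain ⟨S, rfl⟩ := he y hy
  have h1 : (1 - b * S : Cb) ≠ 0 := by
    intro h2
    simpa using congrArg constantCoeff h2
  refine he0 ((Submodule.mem_bot Cb).1 (htf.smul_mem h1 ((Submodule.mem_bot Cb).2 ?_)))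
  linear_combination (norm := module) hey

theorem primitive_of_iso (htf : IsSaturated (⊥ : Submodule Cb E)) {L : Sub E} (hL : L.IsNormal)
    {ν : ℂ} (h : Iso L.mod (RankOne ν)) : HasPrimitiveEigenvector (⊥ : Submodule Cb E) ν := by
  obtain ⟨f, hf⟩ := h
  obtain ⟨e, he⟩ := f.surjective (show RankOne ν from (1 : Cb))
  refine ⟨e, notMem_addB_of_isNormal htf hL e.2 ?_ ?_, ?_⟩
  · intro h0
    have : e = 0 := Subtype.ext h0
    rw [this, map_zero] at he
    exact one_ne_zero (α := Cb) he.symm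
  · intro x hx
    refine ⟨(show Cb from f ⟨x, hx⟩), congrArg Subtype.val (f.injective ?_ :
      (show Cb from f ⟨x, hx⟩) • e = ⟨x, hx⟩)⟩
    rw [map_smul, he]
    exact mul_one (M := Cb) _
  · rw [Submodule.mem_bot, sub_eq_zero]
    refine congrArg Subtype.val (f.injective ?_ : a e = (C ν * b) • e)
    rw [hf, map_smul, he, rankOne_a, Derivation.map_one_eq_zero, mul_zero, add_zero]
    rfl

theorem exists_normal_of_primitive (htf : IsSaturated (⊥ : Submodule Cb E)) {ν : ℂ}
    (h : HasPrimitiveEigenvector (⊥ : Submodule Cb E) ν) :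
    ∃ L : Sub E, L.IsNormal ∧ Module.finrank Cb L.mod = 1 ∧ Iso L.mod (RankOne ν) := by
  obtain ⟨e, heB, he⟩ := h
  rw [Submodule.mem_bot, sub_eq_zero] at he
  have he0 : e ≠ 0 := by
    rintro rfl
    exact heB (Submodule.zero_mem _)
  obtain ⟨L, hL⟩ : ∃ L : Sub E, L.mod = Cb ∙ e :=
    ⟨{ mod := Cb ∙ e
       a_mem := by
        intro x hx
        obtain ⟨S, rfl⟩ := Submodule.mem_span_singleton.1 hx
        rw [a_smul, he]
        have h1 := Submodule.mem_span_singleton_self (R := Cb) e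
        exact Submodule.add_mem _ (Submodule.smul_mem _ _ (Submodule.smul_mem _ _ h1))
          (Submodule.smul_mem _ _ h1) }, rfl⟩
  have heL : e ∈ L.mod := hL ▸ Submodule.mem_span_singleton_self e
  have hLe : ∀ x ∈ L.mod, ∃ S : Cb, S • e = x := fun x hx =>
    Submodule.mem_span_singleton.1 (hL ▸ hx)
  have hiso : Iso L.mod (RankOne ν) := by
    refine iso_rankOne_of_generator (e := (⟨e, heL⟩ : L.mod)) (Subtype.ext he) (fun S hS => ?_) fun x => ?_
    · by_contra hS0
      exact he0 ((Submodule.mem_bot Cb).1 (htf.smul_mem hS0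
        ((Submodule.mem_bot Cb).2 (congrArg Subtype.val hS))))
    · obtain ⟨S, hS⟩ := hLe x x.2
      exact ⟨S, Subtype.ext hS⟩
  refine ⟨L, fun x => ⟨?_, ?_⟩, ?_, hiso⟩
  · rintro ⟨hx, y, hy⟩
    obtain ⟨S, rfl⟩ := hLe x hx
    by_cases hS : constantCoeff S = 0
    · obtain ⟨T, rfl⟩ := PowerSeries.X_dvd_iff.2 hS
      exact ⟨T • e, Submodule.smul_mem _ _ heL, mul_smul _ _ _⟩
    · exact (heB ((smul_mem_addB_iff hS).1 (mem_addB_bot.2 ⟨y, hy⟩))).elim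
  · rintro ⟨y, hy, rfl⟩
    exact ⟨Submodule.smul_mem _ _ hy, y, rfl⟩
  · obtain ⟨f, -⟩ := hiso
    rw [f.finrank_eq, finrank_rankOne]

/-- A generator `e` of `L` has `a e = g e`, and normality keeps it outside `bE`. Nilpotence of `a`
modulo `b` gives `g(0) = 0`, so a unit multiple of `e` is an eigenvector. -/
theorem exists_iso_of_finrank_eq_one {k : ℕ} {F : Fin (k + 1) → Submodule Cb E} {v : Fin k → E}
    {l : Fin k → ℂ} (hF : IsFlag F v l) (htf : IsSaturated (⊥ : Submodule Cb E)) {L : Sub E}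
    (hL : L.IsNormal) (h1 : Module.finrank Cb L.mod = 1) : ∃ ν : ℂ, Iso L.mod (RankOne ν) := by
  have : Module.Finite Cb E := hF.finite
  have htf' : ∀ {S : Cb} {x : E}, S • x = 0 → S ≠ 0 → x = 0 := fun h hS =>
    (Submodule.mem_bot Cb).1 (htf.smul_mem hS ((Submodule.mem_bot Cb).2 h))
  have : Module.IsTorsionFree Cb E := ⟨fun r hr => by
    intro x y hxy
    refine sub_eq_zero.1 (htf' (S := r) ?_ hr.ne_zero)
    rw [smul_sub]
    exact sub_eq_zero.2 hxy⟩
  have : Module.Free Cb L.mod := Module.free_of_finite_type_torsion_free'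
  obtain ⟨e, he0, he⟩ := finrank_eq_one_iff'.1 h1
  have he0' : (e : E) ≠ 0 := fun h => he0 (Subtype.ext h)
  have heB : (e : E) ∉ addB (⊥ : Submodule Cb E) :=
    notMem_addB_of_isNormal htf hL e.2 he0' fun x hx => by
      obtain ⟨S, hS⟩ := he ⟨x, hx⟩
      exact ⟨S, congrArg Subtype.val hS⟩
  obtain ⟨g, hg⟩ := he (a e)
  have hg0 := hF.constantCoeff_eq_zero (congrArg Subtype.val hg).symm heB
  obtain ⟨ν, u, hu, hν⟩ := exists_isUnit_smul_eigenvector hg.symm hg0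
  refine ⟨ν, iso_rankOne_of_generator hν (fun S hS => ?_) fun x => ?_⟩
  · rw [smul_smul] at hS
    exact (mul_eq_zero.1 ((smul_eq_zero.1 hS).resolve_right he0)).resolve_right hu.ne_zero
  · obtain ⟨S, rfl⟩ := he x
    obtain ⟨u, rfl⟩ := hu
    exact ⟨S * ↑u⁻¹, by rw [smul_smul, mul_assoc, Units.inv_mul, mul_one]⟩

/-- The numbers `ν` for which `E` has a normal submodule isomorphic to `E_ν` are read off from any
Jordan–Hölder sequence of the semi-simple part. -/
theorem primitive_iff_of_isJordanHolder [Module.Finite Cb E]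
    (htf : IsSaturated (⊥ : Submodule Cb E)) (hK : KerLeOne (⊥ : Submodule Cb E)) {S : Sub E}
    (hS : S = eigenSaturation E) {d : ℕ} {G : Fin (d + 1) → Sub S.mod} {mu : Fin d → ℂ}
    (hG : IsJordanHolder G mu) (ν : ℂ) :
    HasPrimitiveEigenvector (⊥ : Submodule Cb E) ν ↔ ∃ i : Fin d, ν = mu i + (i : ℕ) := by
  subst hS
  obtain ⟨-, e, he⟩ := hG.exists_isFlag
  have hK' := hK.sub (isSaturated_eigenSaturation (E := E))
  rw [← primitive_eigenSaturation_iff]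
  refine ⟨he.exists_eq_of_primitive hK', ?_⟩
  rintro ⟨i, rfl⟩
  exact he.primitive hK' (isSemisimple_eigenSaturation htf).isSeparated i

end

end FormalAB

end

/-- The indices `j` and `i` start at `0`, so that `lam j + j` and `mu i + i` are the numbers
`λ_j + j - 1` and `μ_i + i - 1` for indices that start at `1`. -/
theorem corollary2p4p5 {E : Type*} [AddCommGroup E] [Module FormalAB.Cb E] [FormalAB.ABAction E]
    (hE : FormalAB.IsFresco E)
    (k : ℕ) (F : Fin (k + 1) → FormalAB.Sub E) (lam : Fin k → ℂ)
    (hF : FormalAB.IsJordanHolder F lam)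
    (d : ℕ) (G : Fin (d + 1) → FormalAB.Sub (FormalAB.semisimplePart E).mod) (mu : Fin d → ℂ)
    (hG : FormalAB.IsJordanHolder G mu) :
    (∀ j : Fin k,
      (∃ L : FormalAB.Sub E, L.IsNormal ∧ Module.finrank FormalAB.Cb L.mod = 1 ∧
          FormalAB.Iso L.mod (FormalAB.RankOne (lam j + (j : ℕ)))) ↔
        ∃ i : Fin d, lam j + (j : ℕ) = mu i + (i : ℕ)) ∧
    (∀ L : FormalAB.Sub E, L.IsNormal → Module.finrank FormalAB.Cb L.mod = 1 →
      ∃ j : Fin k, (∃ i : Fin d, lam j + (j : ℕ) = mu i + (i : ℕ)) ∧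
        FormalAB.Iso L.mod (FormalAB.RankOne (lam j + (j : ℕ)))) := by
  obtain ⟨hb, e, he⟩ := hF.exists_isFlag
  have htf : FormalAB.IsSaturated (⊥ : Submodule FormalAB.Cb E) := fun x hx =>
    (Submodule.mem_bot _).2 (hb x ((Submodule.mem_bot _).1 hx))
  have := he.finite
  have hK : FormalAB.KerLeOne (⊥ : Submodule FormalAB.Cb E) := by
    obtain ⟨Λ, N, V, _, _, _, φ, -, hφ⟩ := hE
    obtain ⟨x, hx⟩ := FormalAB.exists_generator_mod hφ
    exact FormalAB.kerLeOne_of_generator hx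
  have hmu := FormalAB.primitive_iff_of_isJordanHolder htf hK
    (FormalAB.semisimplePart_eq htf) hG
  refine ⟨fun j => ⟨?_, fun h => FormalAB.exists_normal_of_primitive htf ((hmu _).2 h)⟩, ?_⟩
  · rintro ⟨L, hL, -, hiso⟩
    exact (hmu _).1 (FormalAB.primitive_of_iso htf hL hiso)
  · intro L hL h1
    obtain ⟨ν, hν⟩ := FormalAB.exists_iso_of_finrank_eq_one he htf hL h1
    have hp := FormalAB.primitive_of_iso htf hL hν
    obtain ⟨j, rfl⟩ := he.exists_eq_of_primitive hK hp
    exact ⟨j, (hmu _).1 hp, hν⟩
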